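/- Let $\pi:V\to W$ be a surjective linear map of finite-dimensional real vector spaces, $P\subset V$ a full-dimensional polytope, $Q=\pi(P)$, and let $\pi^\vee:V^*\to(\ker\pi)^*$ be the restriction map. Faces of $P$ are nonempty; $N(P,F)\subset V^*$ is the closed normal cone of a face $F$ (the linear functions whose maximum on $P$ is attained at every point of $F$), and $\Delta(P)=\{N(P,F)\}$. For $q\in Q$ the cell $[q]$ is the intersection of all $\pi(F)$ ($F$ a face of $P$) containing $q$, and $\Gamma$ is the set of cells; for $\psi\in(\ker\pi)^*$ the cone $[\psi]$ is the intersection of all $\pi^\vee N(P,F)$ containing $\psi$, and $\Gamma^*$ is the set of these cones. Both are ordered by inclusion. Let $P_q=P\cap\pi^{-1}(q)$, let $P_q^\psi$ be the face of $P_q$ on which $\psi$ is maximal, and $F_{q,\psi}$ the smallest face of $P$ containing $P_q^\psi$; it depends only on the cell $c$ with $q\in\operatorname{relint}c$ and on the cone $\sigma\in\Gamma^*$ with $\psi\in\operatorname{relint}\sigma$, so one also writes $F_{c,\psi}$, $F_{q,\sigma}$. Let $[\psi]_c$ be the smallest cone containing $\psi$ in the normal fan of $P_q$, $q\in\operatorname{relint}c$,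 and let $[q]_\sigma$ be the smallest set containing $q$ among the $\pi(F_{p,\sigma})$, $p\in Q$. - A map $\Psi:\Gamma\to(\ker\pi)^*$ is coherent if $\operatorname{relint}[\Psi(c)]_c\subset\operatorname{relint}[\Psi(c')]_{c'}$ whenever $c'\subset c$. For coherent $\Psi$, $\mathcal F(\Psi)=\{F_{c,\Psi(c)}\mid c\in\Gamma\}$ is a locally coherent string and $\mathcal C(\Psi)=\{N(P,F_{c,\Psi(c)})\mid c\in\Gamma\}$ is a virtual cone. - A map $\kappa:\Gamma^*\to Q$ is coherent if $\operatorname{relint}[\kappa(\sigma)]_\sigma\subset\operatorname{relint}[\kappa(\sigma')]_{\sigma'}$ whenever $\sigma'\subset\sigma$. For coherent $\kappa$, $\mathcal F(\kappa)=\{F_{\kappa(\sigma),\sigma}\mid\sigma\in\Gamma^*\}$ is a virtual cell. - A locally coherent costring is a set $\mathcal C\subset\Delta(P)$ such that $C\mapsto\pi^\vee(C)$ is injective on $\mathcal C$, the $\pi^\vee(C)$, $C\in\mathcal C$, form a finite fan of polyhedral cones (closed under faces, any two meeting in a common face, lineality allowed) with support $(\ker\pi)^*$, and, for $C,D\in\mathcal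 C$, $\pi^\vee(C)\subset\pi^\vee(D)$ if and only if $C=(\pi^\vee)^{-1}(\pi^\vee(C))\cap D$. Let $\mathcal T,\Gamma^*_{vir},\Gamma_{vir},\mathcal T^*$ be the sets of locally coherent strings, virtual cones, virtual cells, locally coherent costrings. Order $\mathcal T$ and $\mathcal T^*$ by inclusion of the unions of their members. Order $\Gamma^*_{vir}$ by $\mathcal C(\Psi)\le\mathcal C(\Phi)$ iff $N(P,F_{c,\Psi(c)})\subset N(P,F_{c,\Phi(c)})$ for all $c\in\Gamma$, and $\Gamma_{vir}$ by $\mathcal F(\kappa)\le\mathcal F(\mu)$ iff $F_{\kappa(\sigma),\sigma}\subset F_{\mu(\sigma),\sigma}$ for all $\sigma\in\Gamma^*$. **Theorem A.** 1. A collection $\mathcal F$ of faces of $P$ is a locally coherent string if and only if $\{N(P,F)\mid F\in\mathcal F\}$ is a virtual cone. 2. A collection $\mathcal F$ of faces of $P$ is a virtual cell if and only if $\{N(P,F)\mid F\in\mathcal F\}$ is a locally coherent costring. 3. A collection $\mathcal C\subset\Delta(P)$ is a locally coherent costring if and only if $\{F\mid N(P,F)\in\mathcal C\}$ is a virtual cell.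 4. A collection $\mathcal C\subset\Delta(P)$ is a virtual cone if and only if $\{F\mid N(P,F)\in\mathcal C\}$ is a locally coherent string. The four relations above are partial orders, and each of these correspondences is an order-reversing bijection (in both directions), so $\mathcal T\cong(\Gamma^*_{vir})^{op}$ and $\mathcal T^*\cong(\Gamma_{vir})^{op}$. The first extends the anti-isomorphism $\sigma\mapsto\mathcal F(\sigma)=\{F_{q,\sigma}\mid q\in Q\}$ of $\Gamma^*$ onto the set $\mathcal T_{coh}\subset\mathcal T$ of coherent strings $\{F_{c,\psi}\mid c\in\Gamma\}$, $\psi\in(\ker\pi)^*$: sending $\sigma$ to the virtual cone of a constant map with value in $\operatorname{relint}\sigma$ embeds the poset $\Gamma^*$ in $\Gamma^*_{vir}$, and this virtual cone corresponds to $\mathcal F(\sigma)$. The second extends the anti-isomorphism $c\mapsto\Delta(c)=\{N(P,F_{c,\psi})\mid\psi\in(\ker\pi)^*\}$ of $\Gamma$ onto the set $\mathcal T^*_{coh}\subset\mathcal T^*$ of coherent costrings: sending $c$ to the virtual cell of a constant map with value in $\operatorname{relint}c$ embeds the poset $\Gamma$ in $\Gamma_{vir}$, and this virtual cell corresponds to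 $\Delta(c)$. -/

import Mathlib

/-! Projections of polytopes and of their normal fans.

Throughout `π : V → W` is a linear map of finite dimensional real vector spaces, `P ⊆ V` is a
polytope and `Q = π(P)`.  Dual spaces carry their usual topology and `relint` is Mathlib's
`intrinsicInterior ℝ`. -/

open Set

namespace FanDuality

section Orders

variable {α β : Type*}

/-- `r` restricts to a partial order on `A`. -/
structure IsPartialOrderOn (A : Set α) (r : α → α → Prop) : Prop where
  refl : ∀ a ∈ A, r a a
  trans : ∀ a ∈ A, ∀ b ∈ A, ∀ c ∈ A, r a b → r b c → r a c
  antisymm : ∀ a ∈ A, ∀ b ∈ A, r a b → r b a → a = b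

/-- `f` is an anti-isomorphism from the poset `(A, r)` onto the poset `(B, s)`. -/
structure IsAntiIsoOn (f : α → β) (A : Set α) (r : α → α → Prop)
    (B : Set β) (s : β → β → Prop) : Prop where
  bijOn : BijOn f A B
  rev : ∀ a ∈ A, ∀ a' ∈ A, (r a a' ↔ s (f a') (f a))

/-- `f` embeds the poset `(A, r)` into the poset `(B, s)`. -/
structure IsEmbeddingOn (f : α → β) (A : Set α) (r : α → α → Prop)
    (B : Set β) (s : β → β → Prop) : Prop where
  mapsTo : MapsTo f A B
  injOn : InjOn f A
  iff : ∀ a ∈ A, ∀ a' ∈ A, (r a a' ↔ s (f a) (f a'))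

/-- Collections of sets compared by inclusion of their unions. -/
def UnionLE (A B : Set (Set α)) : Prop := ⋃₀ A ⊆ ⋃₀ B

end Orders

section Polyhedra

variable {E : Type*} [NormedAddCommGroup E] [NormedSpace ℝ E]

/-- A polytope: the convex hull of a finite nonempty set. -/
def IsPolytope (P : Set E) : Prop :=
  ∃ S : Set E, S.Finite ∧ S.Nonempty ∧ P = convexHull ℝ S

/-- A polyhedral cone: the set of nonnegative combinations of finitely many vectors. -/
def IsPolyhedralCone (C : Set E) : Prop :=
  ∃ K : PointedCone ℝ E, K.FG ∧ (K : Set E) = C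

/-- `G` is a nonempty face of the convex set `C`: the set of points of `C` at which some linear
function is maximal on `C`. -/
def IsFace (C G : Set E) : Prop :=
  G.Nonempty ∧ ∃ l : E →L[ℝ] ℝ, G = l.toExposed C

/-- The nonempty faces of `P`. -/
def faces (P : Set E) : Set (Set E) := {F | IsFace P F}

/-- The (closed) normal cone `N(P, F)`: the linear functions that are maximal on `P` at every
point of `F`. -/
def normalCone (P F : Set E) : Set (E →L[ℝ] ℝ) := {l | F ⊆ l.toExposed P}

/-- The normal fan `Δ(P)`. -/
def normalFan (P : Set E) : Set (Set (E →L[ℝ] ℝ)) := normalCone P '' faces P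

/-- `K` is a subdivision of `X` into cones: a finite fan (whose cones need not be strongly
convex) with support `X`. -/
structure IsConeSubdivision (K : Set (Set E)) (X : Set E) : Prop where
  finite : K.Finite
  polyhedral : ∀ C ∈ K, IsPolyhedralCone C
  face_mem : ∀ C ∈ K, ∀ G, IsFace C G → G ∈ K
  inter_face : ∀ C ∈ K, ∀ D ∈ K, IsFace C (C ∩ D) ∧ IsFace D (C ∩ D)
  support : ⋃₀ K = X

end Polyhedra

section Projection

variable {V W : Type*} [NormedAddCommGroup V] [NormedSpace ℝ V]
  [NormedAddCommGroup W] [NormedSpace ℝ W]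

/-- `(ker π)^*`. -/
abbrev KerDual (π : V →L[ℝ] W) : Type _ := (LinearMap.ker π.toLinearMap) →L[ℝ] ℝ

/-- `π^∨ : V^* → (ker π)^*`, the restriction of linear functions to `ker π`. -/
def dualProj (π : V →L[ℝ] W) (l : V →L[ℝ] ℝ) : KerDual π :=
  l.comp (LinearMap.ker π.toLinearMap).subtypeL

variable (P : Set V) (π : V →L[ℝ] W)

/-- The cell `[q]` of a point `q`: the intersection of the `π`-images of all faces of `P` whose
image contains `q`. -/
def cellOf (q : W) : Set W := ⋂₀ {D | ∃ F ∈ faces P, D = π '' F ∧ q ∈ D}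

/-- `Γ(P, Q)`: the cells of the points of `Q`. -/
def cells : Set (Set W) := cellOf P π '' (π '' P)

/-- The cone `[ψ]` of `ψ ∈ (ker π)^*`: the intersection of the `π^∨`-images of all cones of the
normal fan whose image contains `ψ`. -/
def coneOf (ψ : KerDual π) : Set (KerDual π) :=
  ⋂₀ {D | ∃ F ∈ faces P, D = dualProj π '' normalCone P F ∧ ψ ∈ D}

/-- `Γ^*(P, Q)`. -/
def cones : Set (Set (KerDual π)) := range (coneOf P π)

/-- The face `P_q^ψ` of the fibre `P_q = P ∩ π⁻¹(q)` on which `ψ ∈ (ker π)^*` is maximal.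
(On `P_q` the function `ψ` is defined up to a constant; it compares the points `x` and `x + k`
by the sign of `ψ k`.) -/
def fiberFace (q : W) (ψ : KerDual π) : Set V :=
  {x | x ∈ P ∧ π x = q ∧ ∀ k : LinearMap.ker π.toLinearMap, x + (k : V) ∈ P → ψ k ≤ 0}

/-- The normal cone in `(ker π)^*` of a subset `G` of the fibre `P_q`. -/
def fiberNormalCone (q : W) (G : Set V) : Set (KerDual π) := {ψ | G ⊆ fiberFace P π q ψ}

/-- The normal fan `Δ(P_q)` of the fibre `P_q`, in `(ker π)^*`. -/
def fiberFan (q : W) : Set (Set (KerDual π)) :=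
  {C | ∃ ψ : KerDual π, C = fiberNormalCone P π q (fiberFace P π q ψ)}

/-- The minimal cone of the normal fan `Δ(P_q)` that contains `ψ`. For `q` in the relative
interior of a cell `c` this is the cone `[ψ]_c`. -/
def fiberConeOf (q : W) (ψ : KerDual π) : Set (KerDual π) :=
  ⋂₀ {C | C ∈ fiberFan P π q ∧ ψ ∈ C}

/-- `F_{q,ψ}`: the smallest face of `P` that contains `P_q^ψ`. It depends only on the cell whose
relative interior contains `q` and the cone whose relative interior contains `ψ`; so
`F_{c,ψ} = F_{q,ψ}` for all `q ∈ relint c`, and `F_{q,σ} = F_{q,ψ}` for all `ψ ∈ relint σ`. -/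
def minFace (q : W) (ψ : KerDual π) : Set V :=
  ⋂₀ {F | F ∈ faces P ∧ fiberFace P π q ψ ⊆ F}

/-! ### Maps `Γ → (ker π)^*`: strings and virtual cones -/

/-- The collection `{F_{c,Ψ(c)} | c ∈ Γ}` of faces of `P`. -/
def stringOf (Ψ : cells P π → KerDual π) : Set (Set V) :=
  {F | ∃ c : cells P π, ∃ q ∈ intrinsicInterior ℝ (c : Set W), F = minFace P π q (Ψ c)}

/-- The collection `{N(P, F_{c,Ψ(c)}) | c ∈ Γ}` of cones of the normal fan. -/
def virtualConeOf (Ψ : cells P π → KerDual π) : Set (Set (V →L[ℝ] ℝ)) :=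
  {C | ∃ c : cells P π, ∃ q ∈ intrinsicInterior ℝ (c : Set W),
    C = normalCone P (minFace P π q (Ψ c))}

/-- Local coherence of `Ψ : Γ → (ker π)^*`:
`relint [Ψ(c)]_c ⊆ relint [Ψ(c')]_{c'}` whenever `c' ≤ c`. -/
def IsCoherentOnCells (Ψ : cells P π → KerDual π) : Prop :=
  ∀ c c' : cells P π, (c' : Set W) ⊆ c →
    ∀ q ∈ intrinsicInterior ℝ (c : Set W), ∀ q' ∈ intrinsicInterior ℝ (c' : Set W),
      intrinsicInterior ℝ (fiberConeOf P π q (Ψ c)) ⊆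
        intrinsicInterior ℝ (fiberConeOf P π q' (Ψ c'))

/-- The set `T(P, Q)` of locally coherent strings, ordered by `UnionLE`. -/
def strings : Set (Set (Set V)) :=
  {A | ∃ Ψ : cells P π → KerDual π, IsCoherentOnCells P π Ψ ∧ A = stringOf P π Ψ}

/-- The set `Γ^*_vir(P, Q)` of virtual cones. -/
def virtualCones : Set (Set (Set (V →L[ℝ] ℝ))) :=
  {A | ∃ Ψ : cells P π → KerDual π, IsCoherentOnCells P π Ψ ∧ A = virtualConeOf P π Ψ}

/-- The order of virtual cones: inclusion, for every `c ∈ Γ`, of the cones attached to `c`. -/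
def VirtualConeLE (A B : Set (Set (V →L[ℝ] ℝ))) : Prop :=
  ∃ Ψ Φ : cells P π → KerDual π,
    IsCoherentOnCells P π Ψ ∧ A = virtualConeOf P π Ψ ∧
    IsCoherentOnCells P π Φ ∧ B = virtualConeOf P π Φ ∧
    ∀ c : cells P π, ∀ q ∈ intrinsicInterior ℝ (c : Set W),
      normalCone P (minFace P π q (Ψ c)) ⊆ normalCone P (minFace P π q (Φ c))

/-- The coherent string `𝓕(ψ) = {F_{c,ψ} | c ∈ Γ}`. -/
def coherentString (ψ : KerDual π) : Set (Set V) := stringOf P π fun _ => ψ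

/-- The set `T_coh(P, Q)` of coherent strings, ordered by `UnionLE`. -/
def coherentStrings : Set (Set (Set V)) := range (coherentString P π)

/-- The coherent string `𝓕(σ)` of a cone `σ`: the coherent string of the points of `relint σ`. -/
def stringOfCone (σ : Set (KerDual π)) : Set (Set V) :=
  ⋃ ψ ∈ intrinsicInterior ℝ σ, coherentString P π ψ

/-- A cone `σ` as a virtual cone: the one of the constant map with a value in `relint σ`. -/
def virtualConeOfCone (σ : Set (KerDual π)) : Set (Set (V →L[ℝ] ℝ)) :=
  ⋃ ψ ∈ intrinsicInterior ℝ σ, virtualConeOf P π fun _ => ψ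

/-! ### Maps `Γ^* → Q`: virtual cells; and costrings -/

/-- The minimal cell of the subdivision `{π(F) | F ∈ 𝓕(ψ)}` of `Q` that contains `q`. For `ψ` in
the relative interior of a cone `σ` this is `[q]_σ`. -/
def stringCellOf (q : W) (ψ : KerDual π) : Set W :=
  ⋂₀ {D | ∃ F ∈ coherentString P π ψ, D = π '' F ∧ q ∈ D}

/-- The collection `{F_{κ(σ),σ} | σ ∈ Γ^*}` of faces of `P`. -/
def virtualCellOf (κ : cones P π → π '' P) : Set (Set V) :=
  {F | ∃ σ : cones P π, ∃ ψ ∈ intrinsicInterior ℝ (σ : Set (KerDual π)),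
    F = minFace P π (κ σ) ψ}

/-- Local coherence of `κ : Γ^* → Q`:
`relint [κ(σ)]_σ ⊆ relint [κ(σ')]_{σ'}` whenever `σ' ≤ σ`. -/
def IsCoherentOnCones (κ : cones P π → π '' P) : Prop :=
  ∀ σ σ' : cones P π, (σ' : Set (KerDual π)) ⊆ σ →
    ∀ ψ ∈ intrinsicInterior ℝ (σ : Set (KerDual π)),
    ∀ ψ' ∈ intrinsicInterior ℝ (σ' : Set (KerDual π)),
      intrinsicInterior ℝ (stringCellOf P π (κ σ) ψ) ⊆
        intrinsicInterior ℝ (stringCellOf P π (κ σ') ψ')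

/-- The set `Γ_vir(P, Q)` of virtual cells. -/
def virtualCells : Set (Set (Set V)) :=
  {A | ∃ κ : cones P π → π '' P, IsCoherentOnCones P π κ ∧ A = virtualCellOf P π κ}

/-- The order of virtual cells: inclusion, for every `σ ∈ Γ^*`, of the faces attached to `σ`. -/
def VirtualCellLE (A B : Set (Set V)) : Prop :=
  ∃ κ μ : cones P π → π '' P,
    IsCoherentOnCones P π κ ∧ A = virtualCellOf P π κ ∧
    IsCoherentOnCones P π μ ∧ B = virtualCellOf P π μ ∧
    ∀ σ : cones P π, ∀ ψ ∈ intrinsicInterior ℝ (σ : Set (KerDual π)),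
      minFace P π (κ σ) ψ ⊆ minFace P π (μ σ) ψ

/-- A cell `c` as a virtual cell: the one of the constant map with a value in `relint c`. -/
def virtualCellOfCell (c : Set W) : Set (Set V) :=
  {F | ∃ q ∈ intrinsicInterior ℝ c, ∃ hq : q ∈ π '' P, F ∈ virtualCellOf P π fun _ => ⟨q, hq⟩}

/-- `C` is a locally coherent costring of `π^∨ : |D| → π^∨(|D|)`, where `D` is a fan in `V^*`. -/
structure IsCostring (D C : Set (Set (V →L[ℝ] ℝ))) : Prop where
  subset : C ⊆ D
  /-- The images of the members form a cone subdivision of `π^∨(|D|)` … -/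
  subdivision : IsConeSubdivision ((fun s => dualProj π '' s) '' C) (dualProj π '' ⋃₀ D)
  /-- … without repetition. -/
  noRepetition : InjOn (fun s => dualProj π '' s) C
  lift : ∀ s ∈ C, ∀ t ∈ C, (dualProj π '' s ⊆ dualProj π '' t ↔
    s = dualProj π ⁻¹' (dualProj π '' s) ∩ t)

/-- The set `T^*(P, Q)` of locally coherent costrings of `π^∨ : |Δ(P)| → (ker π)^*`, ordered by
`UnionLE`. -/
def costrings : Set (Set (Set (V →L[ℝ] ℝ))) := {C | IsCostring π (normalFan P) C}

/-- The coherent costring `Δ(q) = {N(P, F_{q,ψ}) | ψ ∈ (ker π)^*}`. -/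
def coherentCostring (q : W) : Set (Set (V →L[ℝ] ℝ)) :=
  range fun ψ : KerDual π => normalCone P (minFace P π q ψ)

/-- The set `T^*_coh(P, Q)` of coherent costrings, ordered by `UnionLE`. -/
def coherentCostrings : Set (Set (Set (V →L[ℝ] ℝ))) := coherentCostring P π '' (π '' P)

/-- The coherent costring `Δ(c)` of a cell `c`: the coherent costring of the points of
`relint c`. -/
def costringOfCell (c : Set W) : Set (Set (V →L[ℝ] ℝ)) :=
  ⋃ q ∈ intrinsicInterior ℝ c, coherentCostring P π q

/-- The collection `{N(P, F) | F ∈ A}` of normal cones of a collection `A` of faces. -/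
def conesOf (A : Set (Set V)) : Set (Set (V →L[ℝ] ℝ)) := normalCone P '' A

/-- The collection `{F | N(P, F) ∈ C}` of faces of a collection `C` of normal cones. -/
def facesOf (C : Set (Set (V →L[ℝ] ℝ))) : Set (Set V) := {F | F ∈ faces P ∧ normalCone P F ∈ C}

end Projection

end FanDuality

/-! For `q ∈ Q` and `ψ ∈ (ker π)^*`, strict complementarity in linear programming says that
`F_{q,ψ}` is the only face `F` with `q ∈ relint π(F)` and `ψ ∈ relint π^∨ N(P, F)`. The products
`relint π(F) × relint π^∨ N(P, F)` therefore partition `Q × (ker π)^*`. Such a partition is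
self-dual: exchanging the two factors exchanges cells with cones and strings with virtual cells. For
a coherent map `Ψ` the map `q ↦ F_{q,Ψ(q)}` is locally constant on the connected set `relint π(F)`
for every member `F` of the string. Hence the union of the string meets the fibre over `q` in that
of `F_{q,Ψ(q)}`, so the string determines all the faces `F_{q,Ψ(q)}`, and inclusion of unions is the
pointwise order. Finally, a face and its normal cone determine each other, and the axioms of a
costring say that its cones `N(P, F)` come from a coherent map on `(ker π)^*`: the lifting condition
amounts to `relint π(F) ⊆ relint π(G)` whenever `π^∨ N(P, G)` is a face of `π^∨ N(P, F)`, which is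
proved by moving points of `relint F` along `ker π`. -/

namespace FanDuality

section RelativeInterior

variable {E E' : Type*} [NormedAddCommGroup E] [NormedSpace ℝ E]
  [NormedAddCommGroup E'] [NormedSpace ℝ E']

theorem exists_add_smul_sub_mem_of_mem_intrinsicInterior {C : Set E} {x y : E}
    (hx : x ∈ intrinsicInterior ℝ C) (hy : y ∈ C) : ∃ ε > (0 : ℝ), x + ε • (x - y) ∈ C := by
  obtain ⟨⟨x, hx_span⟩, hx_int, rfl⟩ := mem_intrinsicInterior.1 hx
  have hmem (t : ℝ) : x + t • (x - y) ∈ affineSpan ℝ C := by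
    have := AffineMap.lineMap_mem (-t) hx_span (subset_affineSpan ℝ C hy)
    rwa [AffineMap.lineMap_apply_module', show -t • (y - x) + x = x + t • (x - y) by module]
      at this
  let g : ℝ → affineSpan ℝ C := fun t => ⟨x + t • (x - y), hmem t⟩
  have hg : Continuous g := Continuous.subtype_mk (by fun_prop) _
  have hg_zero : g 0 = ⟨x, hx_span⟩ := by simp only [g, zero_smul, add_zero]
  have hnhds := hg.continuousAt.preimage_mem_nhds (x := 0)
    (by rw [hg_zero]; exact mem_interior_iff_mem_nhds.1 hx_int)
  obtain ⟨ε, hε, hball⟩ := Metric.mem_nhds_iff.1 hnhds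
  refine ⟨ε / 2, half_pos hε, hball (?_ : ε / 2 ∈ Metric.ball 0 ε)⟩
  rw [mem_ball_zero_iff, Real.norm_eq_abs, abs_of_pos (half_pos hε)]
  exact half_lt_self hε

theorem combo_intrinsicInterior_self_mem_intrinsicInterior {C : Set E} (hC : Convex ℝ C) {x y : E}
    (hx : x ∈ intrinsicInterior ℝ C) (hy : y ∈ C) {a b : ℝ} (ha : 0 < a) (hb : 0 ≤ b)
    (hab : a + b = 1) : a • x + b • y ∈ intrinsicInterior ℝ C := by
  obtain ⟨⟨x, hx_span⟩, hx_int, rfl⟩ := mem_intrinsicInterior.1 hx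
  have hmem (t : ℝ) (u : E) (hu : u ∈ affineSpan ℝ C) : y + t • (u - y) ∈ affineSpan ℝ C := by
    have := AffineMap.lineMap_mem t (subset_affineSpan ℝ C hy) hu
    rwa [AffineMap.lineMap_apply_module', add_comm] at this
  have hcombo : a • x + b • y = y + a • (x - y) := by
    rw [eq_sub_of_add_eq' hab]
    module
  have hcombo_span : a • x + b • y ∈ affineSpan ℝ C := hcombo ▸ hmem a x hx_span
  -- The homothety with centre `y` and ratio `a⁻¹` sends `a • x + b • y` to `x`.
  let g : affineSpan ℝ C → affineSpan ℝ C := fun u => ⟨y + a⁻¹ • ((u : E) - y), hmem _ _ u.2⟩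
  have hg : Continuous g := Continuous.subtype_mk (by fun_prop) _
  have hgx : g ⟨a • x + b • y, hcombo_span⟩ = ⟨x, hx_span⟩ := by
    ext
    simp only [g, hcombo, add_sub_cancel_left, smul_smul, inv_mul_cancel₀ ha.ne', one_smul,
      add_sub_cancel]
  refine mem_intrinsicInterior.2 ⟨⟨_, hcombo_span⟩, mem_interior_iff_mem_nhds.2 ?_, rfl⟩
  have hnhds := hg.continuousAt.preimage_mem_nhds
    (by rw [hgx]; exact mem_interior_iff_mem_nhds.1 hx_int)
  filter_upwards [hnhds] with u hu
  have hgu : y + a⁻¹ • ((u : E) - y) ∈ C := hu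
  have := hC hgu hy ha.le hb hab
  rwa [smul_add, smul_smul, mul_inv_cancel₀ ha.ne', one_smul,
    show a • y + ((u : E) - y) + b • y = (a + b) • y + ((u : E) - y) by module, hab, one_smul,
    add_sub_cancel] at this

theorem convex_intrinsicInterior {C : Set E} (hC : Convex ℝ C) :
    Convex ℝ (intrinsicInterior ℝ C) := by
  intro x hx y hy a b ha hb hab
  rcases ha.eq_or_lt with rfl | ha
  · rw [zero_add] at hab
    rwa [hab, zero_smul, one_smul, zero_add]
  · exact combo_intrinsicInterior_self_mem_intrinsicInterior hC hx (intrinsicInterior_subset hy)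
      ha hb hab

theorem mem_intrinsicInterior_of_add_smul_sub_mem {C : Set E} (hC : Convex ℝ C) {x z : E} {ε : ℝ}
    (hz : z ∈ intrinsicInterior ℝ C) (hε : 0 < ε) (hx : x + ε • (x - z) ∈ C) :
    x ∈ intrinsicInterior ℝ C := by
  have := combo_intrinsicInterior_self_mem_intrinsicInterior hC hz hx (a := ε / (1 + ε))
    (b := 1 / (1 + ε)) (by positivity) (by positivity) (by field_simp; ring)
  convert this using 1
  match_scalars <;> field_simp
  ring

section FiniteDimensional

variable [FiniteDimensional ℝ E]

theorem mem_intrinsicInterior_iff_exists {C : Set E} (hC : Convex ℝ C) {x : E} :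
    x ∈ intrinsicInterior ℝ C ↔ x ∈ C ∧ ∀ y ∈ C, ∃ ε > (0 : ℝ), x + ε • (x - y) ∈ C := by
  refine ⟨fun hx => ⟨intrinsicInterior_subset hx, fun y hy =>
    exists_add_smul_sub_mem_of_mem_intrinsicInterior hx hy⟩, fun ⟨hx, h⟩ => ?_⟩
  obtain ⟨z, hz⟩ := Set.Nonempty.intrinsicInterior hC ⟨x, hx⟩
  obtain ⟨ε, hε, hw⟩ := h z (intrinsicInterior_subset hz)
  exact mem_intrinsicInterior_of_add_smul_sub_mem hC hz hε hw

open Filter Topology in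
theorem mem_intrinsicInterior_iff_eventually {C : Set E} (hC : Convex ℝ C) {x : E} :
    x ∈ intrinsicInterior ℝ C ↔
      x ∈ C ∧ ∀ y ∈ C, ∀ᶠ ε in 𝓝[>] (0 : ℝ), x + ε • (x - y) ∈ C := by
  rw [mem_intrinsicInterior_iff_exists hC]
  refine and_congr_right fun hx => forall₂_congr fun y _ => ⟨?_, fun h => ?_⟩
  · rintro ⟨ε, hε, h⟩
    filter_upwards [Ioc_mem_nhdsGT hε] with δ hδ
    have hδε : x + δ • (x - y) = (1 - δ / ε) • x + (δ / ε) • (x + ε • (x - y)) := by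
      match_scalars <;> field_simp
      ring
    rw [hδε]
    exact hC hx h (sub_nonneg.2 ((div_le_one hε).2 hδ.2)) (div_pos hδ.1 hε).le (by ring)
  · obtain ⟨ε, hmem, hε⟩ := (h.and self_mem_nhdsWithin).exists
    exact ⟨ε, hε, hmem⟩

theorem mem_intrinsicInterior_biInter_iff {ι : Type*} {J : Set ι} (hJ : J.Finite) {C : ι → Set E}
    (hC : ∀ i ∈ J, Convex ℝ (C i)) {z : E} (hz : ∀ i ∈ J, z ∈ intrinsicInterior ℝ (C i)) {x : E} :
    x ∈ intrinsicInterior ℝ (⋂ i ∈ J, C i) ↔ ∀ i ∈ J, x ∈ intrinsicInterior ℝ (C i) := by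
  constructor
  · intro hx i hi
    obtain ⟨ε, hε, h⟩ := exists_add_smul_sub_mem_of_mem_intrinsicInterior hx
      (mem_iInter₂.2 fun j hj => intrinsicInterior_subset (hz j hj))
    exact mem_intrinsicInterior_of_add_smul_sub_mem (hC i hi) (hz i hi) hε (mem_iInter₂.1 h i hi)
  · intro h
    refine (mem_intrinsicInterior_iff_eventually (convex_iInter₂ hC)).2
      ⟨mem_iInter₂.2 fun i hi => intrinsicInterior_subset (h i hi), fun y hy => ?_⟩
    have := (Filter.eventually_all_finite hJ).2 fun i hi =>
      ((mem_intrinsicInterior_iff_eventually (hC i hi)).1 (h i hi)).2 y (mem_iInter₂.1 hy i hi)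
    filter_upwards [this] with ε hε
    exact mem_iInter₂.2 hε

theorem intrinsicInterior_linearMap_image [FiniteDimensional ℝ E'] (f : E →ₗ[ℝ] E') {C : Set E}
    (hC : Convex ℝ C) : intrinsicInterior ℝ (f '' C) = f '' intrinsicInterior ℝ C := by
  ext p
  constructor
  · intro hp
    obtain ⟨x, hx⟩ := Set.Nonempty.intrinsicInterior hC
      (image_nonempty.1 ⟨p, intrinsicInterior_subset hp⟩)
    obtain ⟨ε, hε, y, hy, hyp⟩ := exists_add_smul_sub_mem_of_mem_intrinsicInterior hp
      (mem_image_of_mem f (intrinsicInterior_subset hx))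
    refine ⟨_, combo_intrinsicInterior_self_mem_intrinsicInterior hC hx hy (a := ε / (1 + ε))
      (b := 1 / (1 + ε)) (by positivity) (by positivity) (by field_simp; ring), ?_⟩
    rw [map_add, map_smul, map_smul, hyp]
    match_scalars <;> field_simp
    ring
  · rintro ⟨x, hx, rfl⟩
    refine (mem_intrinsicInterior_iff_exists (hC.linear_image f)).2
      ⟨mem_image_of_mem f (intrinsicInterior_subset hx), ?_⟩
    rintro _ ⟨y, hy, rfl⟩
    obtain ⟨ε, hε, h⟩ := exists_add_smul_sub_mem_of_mem_intrinsicInterior hx hy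
    exact ⟨ε, hε, _, h, by rw [map_add, map_smul, map_sub]⟩

end FiniteDimensional

end RelativeInterior

section MinkowskiWeyl

variable {R M N : Type*} [Field R] [LinearOrder R] [IsStrictOrderedRing R]
  [AddCommGroup M] [Module R M] [AddCommGroup N] [Module R N] {p : M →ₗ[R] N →ₗ[R] R}

theorem exists_nonneg_sub_smul_iff (T : Finset M) (v x : N) :
    (∃ r : R, 0 ≤ r ∧ ∀ t ∈ T, 0 ≤ p t (x - r • v)) ↔
      (∀ t ∈ T, 0 ≤ p t v → 0 ≤ p t x) ∧
        ∀ s ∈ T, 0 < p s v → ∀ t ∈ T, p t v < 0 → 0 ≤ p (p s v • t - p t v • s) x := by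
  simp only [map_sub, map_smul, LinearMap.sub_apply, LinearMap.smul_apply, smul_eq_mul, sub_nonneg]
  constructor
  · rintro ⟨r, hr, h⟩
    exact ⟨fun t ht htv => (mul_nonneg hr htv).trans (h t ht), fun s hs hsv t ht htv => by
      nlinarith [mul_le_mul_of_nonneg_left (h t ht) hsv.le,
        mul_le_mul_of_nonpos_left (h s hs) htv.le]⟩
  · rintro ⟨hnonneg, hpair⟩
    -- The least admissible `r` is the largest of the lower bounds `0` and `t x / t v`, `t v < 0`.
    let L : Finset R := insert 0 ({t ∈ T | p t v < 0}.image fun t => p t x / p t v)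
    have hL : L.Nonempty := Finset.insert_nonempty _ _
    refine ⟨L.max' hL, L.le_max' 0 (Finset.mem_insert_self _ _), fun t ht => ?_⟩
    rcases lt_trichotomy (p t v) 0 with hneg | hzero | hpos
    · exact (div_le_iff_of_neg hneg).1 (L.le_max' _ (Finset.mem_insert_of_mem
        (Finset.mem_image_of_mem _ (Finset.mem_filter.2 ⟨ht, hneg⟩))))
    · simpa only [hzero, mul_zero] using hnonneg t ht hzero.ge
    · rw [← le_div_iff₀ hpos]
      refine L.max'_le hL _ fun l hl => ?_
      rcases Finset.mem_insert.1 hl with rfl | hl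
      · exact div_nonneg (hnonneg t ht hpos.le) hpos.le
      · obtain ⟨s, hs, rfl⟩ := Finset.mem_image.1 hl
        obtain ⟨hs, hneg⟩ := Finset.mem_filter.1 hs
        rw [div_le_iff_of_neg hneg, div_mul_eq_mul_div, div_le_iff₀ hpos]
        linarith [hpair t ht hpos s hs hneg]

open PointedCone in
theorem dualFG_sup_hull_singleton {K : PointedCone R N} (hK : K.DualFG p) (v : N) :
    (K ⊔ hull R {v}).DualFG p := by
  classical
  obtain ⟨T, rfl⟩ := hK
  refine ⟨{t ∈ T | 0 ≤ p t v} ∪ ({s ∈ T | 0 < p s v} ×ˢ {t ∈ T | p t v < 0}).image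
    fun q => p q.1 v • q.2 - p q.2 v • q.1, ?_⟩
  ext x
  have hmem : x ∈ dual p T ⊔ hull R {v} ↔ ∃ r : R, 0 ≤ r ∧ ∀ t ∈ T, 0 ≤ p t (x - r • v) := by
    rw [Submodule.mem_sup]
    constructor
    · rintro ⟨y, hy, w, hw, rfl⟩
      obtain ⟨r, rfl⟩ := Submodule.mem_span_singleton.1 hw
      refine ⟨r, r.2, fun t ht => ?_⟩
      rw [Nonneg.coe_smul, add_sub_cancel_right]
      exact hy ht
    · rintro ⟨r, hr, h⟩
      exact ⟨_, fun t ht => h t ht, _, Submodule.mem_span_singleton.2 ⟨⟨r, hr⟩, rfl⟩,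
        sub_add_cancel _ _⟩
  rw [hmem, exists_nonneg_sub_smul_iff, mem_dual]
  simp only [Finset.coe_union, Finset.coe_filter, Finset.coe_image, Finset.coe_product, mem_union,
    mem_ofPred_eq, mem_image, mem_prod, Prod.exists, or_imp, forall_and, and_imp,
    forall_exists_index]
  refine and_congr Iff.rfl ⟨?_, ?_⟩
  · intro h s hs hsv t ht htv
    exact h _ s t hs hsv ht htv rfl
  · rintro h _ s t hs hsv ht htv rfl
    exact h s hs hsv t ht htv

theorem dualFG_bot [FiniteDimensional R N] [p.IsPerfPair] :
    (⊥ : PointedCone R N).DualFG p := by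
  classical
  let b := Module.finBasis R N
  choose f hf using fun i => (LinearMap.IsPerfPair.bijective_left p).2 (b.coord i)
  refine ⟨Finset.univ.image f ∪ Finset.univ.image (-f), SetLike.ext fun x => ?_⟩
  simp only [PointedCone.mem_dual, Finset.coe_union, Finset.coe_image, Finset.coe_univ, image_univ,
    mem_union, mem_range, or_imp, forall_and, forall_exists_index, forall_apply_eq_imp_iff,
    Pi.neg_apply, map_neg, LinearMap.neg_apply, hf, Left.nonneg_neg_iff, Submodule.mem_bot]
  constructor
  · rintro ⟨h, h'⟩
    exact b.forall_coord_eq_zero_iff.1 fun i => le_antisymm (h' i) (h i)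
  · intro hx
    simp only [hx, map_zero, le_refl, implies_true, and_self]

theorem dualFG_of_fg [FiniteDimensional R N] [p.IsPerfPair] {K : PointedCone R N} (hK : K.FG) :
    K.DualFG p := by
  classical
  obtain ⟨S, rfl⟩ := hK
  induction S using Finset.induction_on with
  | empty => simpa only [Finset.coe_empty, Submodule.span_empty] using dualFG_bot
  | insert v S _ ih =>
    rw [Finset.coe_insert, Submodule.span_insert, sup_comm]
    exact dualFG_sup_hull_singleton ih v

theorem fg_dual [FiniteDimensional R M] [p.IsPerfPair] {S : Set M} (hS : S.Finite) :
    (PointedCone.dual p S).FG := by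
  obtain ⟨T, hT⟩ := dualFG_of_fg (p := p.flip) (K := PointedCone.hull R S) (Submodule.fg_span hS)
  have : FiniteDimensional R N := .of_injective p.flip (LinearMap.IsPerfPair.bijective_right p).1
  have hfg : (PointedCone.hull R (T : Set N)).FG := Submodule.fg_span T.finite_toSet
  rw [← PointedCone.dual_hull, ← hT, ← PointedCone.dual_hull (T : Set N),
    (dualFG_of_fg hfg).dual_dual_flip]
  exact hfg

theorem exists_neg_of_notMem_of_fg [FiniteDimensional R N] [p.IsPerfPair] {K : PointedCone R N}
    (hK : K.FG) {x : N} (hx : x ∉ K) : ∃ t : M, (∀ y ∈ K, 0 ≤ p t y) ∧ p t x < 0 := by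
  obtain ⟨T, rfl⟩ := dualFG_of_fg (p := p) hK
  simp only [PointedCone.mem_dual, not_forall, not_le] at hx
  obtain ⟨t, ht, htx⟩ := hx
  exact ⟨t, fun y hy => hy ht, htx⟩

end MinkowskiWeyl

section NormedCones

variable {E : Type*} [NormedAddCommGroup E] [NormedSpace ℝ E] [FiniteDimensional ℝ E]

instance topDualPairing_isPerfPair : (topDualPairing ℝ E).IsPerfPair :=
  .of_injective' (fun _ _ h => ContinuousLinearMap.ext (LinearMap.congr_fun h))
    fun _ _ h => SeparatingDual.eq_iff_forall_dual_eq.2 (LinearMap.congr_fun h)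

theorem isClosed_of_fg {K : PointedCone ℝ E} (hK : K.FG) : IsClosed (K : Set E) := by
  obtain ⟨T, rfl⟩ := dualFG_of_fg (p := topDualPairing ℝ E) hK
  exact PointedCone.isClosed_dual fun l => l.continuous

theorem exists_supporting_of_notMem_intrinsicInterior {M : Type*} [AddCommGroup M] [Module ℝ M]
    (p : M →ₗ[ℝ] E →ₗ[ℝ] ℝ) [p.IsPerfPair] {K : PointedCone ℝ E} (hK : K.FG) {x : E}
    (hx : x ∈ K) (hx_int : x ∉ intrinsicInterior ℝ (K : Set E)) :
    ∃ t : M, (∀ y ∈ K, 0 ≤ p t y) ∧ p t x = 0 ∧ ∃ y ∈ K, 0 < p t y := by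
  have hconv : Convex ℝ (K : Set E) := (K : ConvexCone ℝ E).convex
  rw [mem_intrinsicInterior_iff_exists hconv] at hx_int
  push Not at hx_int
  obtain ⟨y, hy, hxy⟩ := hx_int hx
  have hfg : (K ⊔ PointedCone.hull ℝ {-x}).FG := hK.sup (Submodule.fg_span_singleton _)
  have hmem : -y ∉ K ⊔ PointedCone.hull ℝ {-x} := by
    intro hmem
    obtain ⟨z, hz, w, hw, hzw⟩ := Submodule.mem_sup.1 hmem
    obtain ⟨⟨a, ha⟩, rfl⟩ := Submodule.mem_span_singleton.1 hw
    obtain rfl : z = a • x - y := by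
      have : (⟨a, ha⟩ : {c : ℝ // 0 ≤ c}) • -x = a • -x := rfl
      rw [sub_eq_add_neg, ← hzw, this]
      module
    have hcombo : x + (1 / (a + 1)) • (x - y) = (1 / (a + 1)) • (a • x - y + (x + x)) := by
      match_scalars <;> field_simp
      ring
    refine hxy (1 / (a + 1)) (by positivity) ?_
    rw [hcombo]
    exact K.smul_mem (by positivity) (K.add_mem hz (K.add_mem hx hx))
  obtain ⟨t, ht, hty⟩ := exists_neg_of_notMem_of_fg (p := p) hfg hmem
  have ht_nonneg : ∀ y ∈ K, 0 ≤ p t y := fun y hy => ht y (Submodule.mem_sup_left hy)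
  have htx : 0 ≤ p t (-x) :=
    ht _ (Submodule.mem_sup_right (Submodule.mem_span_singleton_self _))
  rw [map_neg] at htx hty
  exact ⟨t, ht_nonneg, le_antisymm (neg_nonneg.1 htx) (ht_nonneg x hx), y, hy, neg_lt_zero.1 hty⟩

end NormedCones

section Faces

variable {V : Type*} [NormedAddCommGroup V] [NormedSpace ℝ V] {P F G : Set V} {x v : V}
  {l : V →L[ℝ] ℝ}

theorem mem_toExposed : x ∈ l.toExposed P ↔ x ∈ P ∧ ∀ y ∈ P, l y ≤ l x := Iff.rfl

theorem mem_toExposed_convexHull {S : Set V} :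
    x ∈ l.toExposed (convexHull ℝ S) ↔ x ∈ convexHull ℝ S ∧ ∀ s ∈ S, l s ≤ l x :=
  and_congr_right fun _ => ⟨fun h s hs => h s (subset_convexHull ℝ S hs),
    fun h => convexHull_min h (convex_halfSpace_le l.isLinear _)⟩

theorem mem_toExposed_of_le {y : V} (hx : x ∈ l.toExposed P) (hy : y ∈ P) (h : l x ≤ l y) :
    y ∈ l.toExposed P :=
  ⟨hy, fun z hz => (hx.2 z hz).trans h⟩

theorem isFace_toExposed (hx : x ∈ l.toExposed P) : IsFace P (l.toExposed P) := ⟨⟨x, hx⟩, l, rfl⟩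

theorem isFace_self (hP : P.Nonempty) : IsFace P P :=
  ⟨hP, 0, by ext x; simp only [mem_toExposed, zero_apply, le_refl, implies_true, and_true]⟩

namespace IsPolytope

theorem convex (hP : IsPolytope P) : Convex ℝ P := by
  obtain ⟨S, _, _, rfl⟩ := hP
  exact convex_convexHull ℝ S

theorem isCompact (hP : IsPolytope P) : IsCompact P := by
  obtain ⟨S, hS, _, rfl⟩ := hP
  exact Set.Finite.isCompact_convexHull ℝ hS

theorem nonempty (hP : IsPolytope P) : P.Nonempty := by
  obtain ⟨S, _, hS, rfl⟩ := hP
  exact hS.convexHull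

end IsPolytope

namespace IsFace

theorem subset (hF : IsFace P F) : F ⊆ P := by
  obtain ⟨_, l, rfl⟩ := hF
  exact fun x hx => hx.1

theorem isExposed (hF : IsFace P F) : IsExposed ℝ P F := by
  obtain ⟨_, l, rfl⟩ := hF
  exact ContinuousLinearMap.toExposed.isExposed

theorem convex (hP : Convex ℝ P) (hF : IsFace P F) : Convex ℝ F := hF.isExposed.convex hP

theorem isCompact (hP : IsCompact P) (hF : IsFace P F) : IsCompact F := hF.isExposed.isCompact hP

theorem inter (hF : IsFace P F) (hG : IsFace P G) (h : (F ∩ G).Nonempty) : IsFace P (F ∩ G) := by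
  obtain ⟨_, l, rfl⟩ := hF
  obtain ⟨_, m, rfl⟩ := hG
  refine ⟨h, l + m, ?_⟩
  obtain ⟨z, hzl, hzm⟩ := h
  ext x
  constructor
  · rintro ⟨hxl, hxm⟩
    exact ⟨hxl.1, fun y hy => add_le_add (hxl.2 y hy) (hxm.2 y hy)⟩
  · rintro ⟨hx, hlm⟩
    have hsum : l z + m z ≤ l x + m x := hlm z hzl.1
    have hl : l x ≤ l z := hzl.2 x hx
    have hm : m x ≤ m z := hzm.2 x hx
    exact ⟨mem_toExposed_of_le hzl hx (by linarith), mem_toExposed_of_le hzm hx (by linarith)⟩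

theorem subset_of_mem_intrinsicInterior (hG : IsFace P G) (hF : F ⊆ P)
    (hx : x ∈ intrinsicInterior ℝ F) (hxG : x ∈ G) : F ⊆ G := by
  obtain ⟨_, m, rfl⟩ := hG
  intro y hy
  obtain ⟨ε, hε, hmem⟩ := exists_add_smul_sub_mem_of_mem_intrinsicInterior hx hy
  have hle := hxG.2 _ (hF hmem)
  simp only [map_add, map_smul, map_sub, smul_eq_mul, add_le_iff_nonpos_right] at hle
  exact mem_toExposed_of_le hxG (hF hy) (sub_nonpos.1 (nonpos_of_mul_nonpos_right hle hε))

end IsFace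

theorem convex_normalCone : Convex ℝ (normalCone P F) := by
  intro l hl m hm a b ha hb _ x hx
  refine ⟨(hl hx).1, fun y hy => ?_⟩
  exact add_le_add (mul_le_mul_of_nonneg_left ((hl hx).2 y hy) ha)
    (mul_le_mul_of_nonneg_left ((hm hx).2 y hy) hb)

theorem normalCone_anti (h : F ⊆ G) : normalCone P G ⊆ normalCone P F := fun _ hl => h.trans hl

namespace IsFace

theorem normalCone_subset_normalCone_iff (hG : IsFace P G) :
    normalCone P G ⊆ normalCone P F ↔ F ⊆ G := by
  refine ⟨fun h => ?_, normalCone_anti⟩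
  obtain ⟨_, l, rfl⟩ := hG
  exact h (subset_refl (l.toExposed P))

theorem mem_normalCone_iff (hF : IsFace P F) (hx : x ∈ intrinsicInterior ℝ F) :
    l ∈ normalCone P F ↔ x ∈ l.toExposed P :=
  ⟨fun h => h (intrinsicInterior_subset hx), fun h =>
    (isFace_toExposed h).subset_of_mem_intrinsicInterior hF.subset hx h⟩

theorem toExposed_eq_of_mem_intrinsicInterior_normalCone (hF : IsFace P F)
    (hl : l ∈ intrinsicInterior ℝ (normalCone P F)) : l.toExposed P = F := by
  refine Subset.antisymm (fun y hy => ?_) (intrinsicInterior_subset hl)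
  obtain ⟨⟨x, hx⟩, m, rfl⟩ := hF
  obtain ⟨ε, hε, hmem⟩ := exists_add_smul_sub_mem_of_mem_intrinsicInterior hl
    (subset_refl (m.toExposed P))
  have hyx : l y + ε * (l y - m y) ≤ l x + ε * (l x - m x) := (hmem hx).2 y hy.1
  have hxy : l x ≤ l y := hy.2 x hx.1
  have hm : ε * (m x - m y) ≤ 0 := by
    linarith [mul_nonneg hε.le (sub_nonneg.2 hxy)]
  exact mem_toExposed_of_le hx hy.1 (sub_nonpos.1 (nonpos_of_mul_nonpos_right hm hε))

end IsFace

theorem injOn_normalCone : InjOn (normalCone P) (faces P) := fun _ hF _ hG h =>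
  Subset.antisymm (hG.normalCone_subset_normalCone_iff.1 h.ge)
    (hF.normalCone_subset_normalCone_iff.1 h.le)

theorem finite_faces (hP : IsPolytope P) : (faces P).Finite := by
  have hclosure : ∀ F ∈ faces P, closure (convexHull ℝ (F.extremePoints ℝ)) = F := fun F hF =>
    closure_convexHull_extremePoints (IsFace.isCompact hP.isCompact hF) (IsFace.convex hP.convex hF)
  obtain ⟨S, hS, _, rfl⟩ := hP
  have hmaps : MapsTo (fun F => F.extremePoints ℝ) (faces (convexHull ℝ S)) (𝒫 S) := fun F hF =>
    (IsFace.isExposed hF).isExtreme.extremePoints_subset_extremePoints.trans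
      extremePoints_convexHull_subset
  have hinj : InjOn (fun F => F.extremePoints ℝ) (faces (convexHull ℝ S)) :=
    LeftInvOn.injOn (f₁' := fun T => closure (convexHull ℝ T)) hclosure
  exact Finite.of_injOn hmaps hinj hS.powerset

theorem isFace_inter_sInter (hP : P.Nonempty) {X : Set V} (hX : X.Nonempty) (hXP : X ⊆ P)
    {𝒢 : Set (Set V)} (hfin : 𝒢.Finite) (h𝒢 : ∀ G ∈ 𝒢, IsFace P G ∧ X ⊆ G) :
    IsFace P (P ∩ ⋂₀ 𝒢) := by
  induction 𝒢, hfin using Set.Finite.induction_on with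
  | empty => simpa only [sInter_empty, inter_univ] using isFace_self hP
  | @insert F 𝒢 _ _ ih =>
    rw [forall_mem_insert] at h𝒢
    have hX𝒢 : X ⊆ F ∩ (P ∩ ⋂₀ 𝒢) :=
      subset_inter h𝒢.1.2 (subset_inter hXP (subset_sInter fun G hG => (h𝒢.2 G hG).2))
    have := h𝒢.1.1.inter (ih h𝒢.2) (hX.mono hX𝒢)
    rwa [inter_left_comm, ← sInter_insert] at this

theorem isFace_sInter_faces (hP : IsPolytope P) {X : Set V} (hX : X.Nonempty) (hXP : X ⊆ P) :
    IsFace P (⋂₀ {F | F ∈ faces P ∧ X ⊆ F}) := by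
  have hface := isFace_inter_sInter hP.nonempty hX hXP
    ((finite_faces hP).subset (sep_subset _ _)) fun G hG => hG
  have hle : ⋂₀ {F | F ∈ faces P ∧ X ⊆ F} ⊆ P :=
    sInter_subset_of_mem ⟨isFace_self hP.nonempty, hXP⟩
  rwa [inter_eq_self_of_subset_right hle] at hface

theorem exists_add_smul_mem_of_mem_hull {C S : Set V} (hC : Convex ℝ C) (hx : x ∈ C) (hS : S ⊆ C)
    (hv : v ∈ PointedCone.hull ℝ ((fun s => s - x) '' S)) : ∃ ε > (0 : ℝ), x + ε • v ∈ C := by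
  induction hv using Submodule.span_induction with
  | mem v hv =>
    obtain ⟨s, hs, rfl⟩ := hv
    exact ⟨1, one_pos, by simpa only [one_smul, add_sub_cancel] using hS hs⟩
  | zero => exact ⟨1, one_pos, by simpa only [smul_zero, add_zero] using hx⟩
  | add v w _ _ hv hw =>
    obtain ⟨ε, hε, hεv⟩ := hv
    obtain ⟨δ, hδ, hδw⟩ := hw
    refine ⟨ε * δ / (ε + δ), by positivity, ?_⟩
    have := hC hεv hδw (a := δ / (ε + δ)) (b := ε / (ε + δ)) (by positivity) (by positivity)
      (by field_simp; ring)
    convert this using 1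
    match_scalars <;> field_simp
    ring
  | smul a v _ hv =>
    obtain ⟨ε, hε, hεv⟩ := hv
    rw [← Nonneg.coe_smul]
    rcases a.2.eq_or_lt with h0 | hpos
    · exact ⟨1, one_pos, by simpa only [← h0, zero_smul, smul_zero, add_zero] using hx⟩
    · exact ⟨ε / a, div_pos hε hpos, by rwa [smul_smul, div_mul_cancel₀ _ hpos.ne']⟩

section FiniteDimensional

variable [FiniteDimensional ℝ V]

theorem IsPolytope.exists_add_smul_mem (hP : IsPolytope P) (hx : x ∈ P)
    (hv : ∀ l : V →L[ℝ] ℝ, x ∈ l.toExposed P → l v ≤ 0) : ∃ ε > (0 : ℝ), x + ε • v ∈ P := by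
  obtain ⟨S, hS, _, rfl⟩ := hP
  refine exists_add_smul_mem_of_mem_hull (convex_convexHull ℝ S) hx (subset_convexHull ℝ S) ?_
  by_contra hmem
  obtain ⟨l, hl, hlv⟩ := exists_neg_of_notMem_of_fg (p := topDualPairing ℝ V)
    (Submodule.fg_span (hS.image _)) hmem
  have hmax : x ∈ (-l).toExposed (convexHull ℝ S) := mem_toExposed_convexHull.2 ⟨hx, fun s hs => by
    have : 0 ≤ l (s - x) := hl _ (Submodule.subset_span (mem_image_of_mem _ hs))
    rw [map_sub] at this
    simpa only [neg_apply, neg_le_neg_iff] using sub_nonneg.1 this⟩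
  exact (neg_nonpos.1 (hv (-l) hmax)).not_gt hlv

namespace IsFace

theorem intrinsicInterior_nonempty (hP : Convex ℝ P) (hF : IsFace P F) :
    (intrinsicInterior ℝ F).Nonempty :=
  Set.Nonempty.intrinsicInterior (hF.convex hP) hF.1

theorem mem_intrinsicInterior_iff (hP : IsPolytope P) (hF : IsFace P F) :
    x ∈ intrinsicInterior ℝ F ↔ x ∈ F ∧ ∀ G, IsFace P G → x ∈ G → F ⊆ G := by
  refine ⟨fun hx => ⟨intrinsicInterior_subset hx, fun G hG =>
    hG.subset_of_mem_intrinsicInterior hF.subset hx⟩, fun ⟨hxF, hmin⟩ => ?_⟩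
  refine (mem_intrinsicInterior_iff_exists (hF.convex hP.convex)).2 ⟨hxF, fun y hy => ?_⟩
  obtain ⟨ε, hε, hmem⟩ := hP.exists_add_smul_mem (hF.subset hxF) (v := x - y) fun l hl => by
    rw [map_sub, sub_nonpos]
    exact (hmin _ (isFace_toExposed hl) hl hy).2 x hl.1
  refine ⟨ε, hε, ?_⟩
  obtain ⟨_, l, rfl⟩ := hF
  refine mem_toExposed_of_le hxF hmem ?_
  simp only [map_add, map_smul, map_sub, smul_eq_mul, le_add_iff_nonneg_right]
  exact mul_nonneg hε.le (sub_nonneg.2 (hxF.2 y hy.1))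

theorem exists_add_smul_mem (hP : IsPolytope P) (hF : IsFace P F)
    (hx : x ∈ intrinsicInterior ℝ F) (hv : ∀ l ∈ normalCone P F, l v ≤ 0) :
    ∃ ε > (0 : ℝ), x + ε • v ∈ P :=
  hP.exists_add_smul_mem (hF.subset (intrinsicInterior_subset hx)) fun l hl =>
    hv l ((hF.mem_normalCone_iff hx).2 hl)

theorem isPolyhedralCone_normalCone (hP : IsPolytope P) (hF : IsFace P F) :
    IsPolyhedralCone (normalCone P F) := by
  obtain ⟨x, hx⟩ := hF.intrinsicInterior_nonempty hP.convex
  have hxP := hF.subset (intrinsicInterior_subset hx)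
  have hN : ∀ l, l ∈ normalCone P F ↔ x ∈ l.toExposed P := fun l => hF.mem_normalCone_iff hx
  obtain ⟨S, hS, _, rfl⟩ := hP
  refine ⟨PointedCone.dual (topDualPairing ℝ V).flip ((fun s => x - s) '' S),
    fg_dual (hS.image _), ?_⟩
  ext l
  rw [hN, mem_toExposed_convexHull, and_iff_right hxP, SetLike.mem_coe, PointedCone.mem_dual,
    forall_mem_image]
  refine forall₂_congr fun s _ => ?_
  rw [LinearMap.flip_apply, topDualPairing_apply, map_sub, sub_nonneg]

theorem mem_intrinsicInterior_normalCone_iff (hP : IsPolytope P) (hF : IsFace P F) :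
    l ∈ intrinsicInterior ℝ (normalCone P F) ↔ l.toExposed P = F := by
  refine ⟨hF.toExposed_eq_of_mem_intrinsicInterior_normalCone, fun hl => ?_⟩
  obtain ⟨x, hx⟩ := hF.intrinsicInterior_nonempty hP.convex
  obtain ⟨K, hK, hKN⟩ := hF.isPolyhedralCone_normalCone hP
  by_contra hl_int
  rw [← hKN] at hl_int
  have hlK : l ∈ K := hKN.ge hl.ge
  -- A supporting vector `v` of the normal cone at `l` yields a point `x - ε v` of `F` at which
  -- some function of the normal cone is not maximal.
  obtain ⟨v, hv, hlv, m, hmK, hmv⟩ := exists_supporting_of_notMem_intrinsicInterior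
    (topDualPairing ℝ V).flip hK hlK hl_int
  simp only [LinearMap.flip_apply, topDualPairing_apply] at hv hlv hmv
  obtain ⟨ε, hε, hxv⟩ := hF.exists_add_smul_mem hP hx (v := -v) fun f hf => by
    simpa only [map_neg, neg_nonpos] using hv f (hKN.ge hf)
  have hxF := intrinsicInterior_subset hx
  have hxvF : x + ε • -v ∈ F := by
    rw [← hl] at hxF ⊢
    refine mem_toExposed_of_le hxF hxv ?_
    simp only [map_add, map_smul, map_neg, hlv, neg_zero, smul_zero, add_zero, le_refl]
  have hle := (hKN.le hmK hxvF).2 x (hF.subset hxF)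
  simp only [map_add, map_smul, map_neg, smul_eq_mul, mul_neg, le_add_iff_nonneg_right,
    neg_nonneg] at hle
  exact (mul_pos hε hmv).not_ge hle

end IsFace

end FiniteDimensional

end Faces

/-- Two finite families `primal` and `dual` of closed convex sets with a common set `index` of
indices, such that the products of the relative interiors of `primal i` and `dual i` partition
`primalSpace × dualSpace`; `face q ψ` is the index of the product that contains `(q, ψ)`. The
polytope `P` gives the families `π(F)` and `π^∨ N(P, F)`, and all statements about `Γ^*` are the
statements about `Γ` for the pairing with the two families exchanged. -/
structure FacePairing (ι E E' : Type*) [NormedAddCommGroup E] [NormedSpace ℝ E]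
    [NormedAddCommGroup E'] [NormedSpace ℝ E'] where
  index : Set ι
  le : ι → ι → Prop
  primal : ι → Set E
  dual : ι → Set E'
  primalSpace : Set E
  dualSpace : Set E'
  face : E → E' → ι
  finite : index.Finite
  antisymm : ∀ i ∈ index, ∀ j ∈ index, le i j → le j i → i = j
  primal_convex : ∀ i ∈ index, Convex ℝ (primal i)
  primal_isClosed : ∀ i ∈ index, IsClosed (primal i)
  primal_nonempty : ∀ i ∈ index, (primal i).Nonempty
  primal_subset : ∀ i ∈ index, primal i ⊆ primalSpace
  dual_convex : ∀ i ∈ index, Convex ℝ (dual i)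
  dual_isClosed : ∀ i ∈ index, IsClosed (dual i)
  dual_nonempty : ∀ i ∈ index, (dual i).Nonempty
  dual_subset : ∀ i ∈ index, dual i ⊆ dualSpace
  primalSpace_nonempty : primalSpace.Nonempty
  dualSpace_nonempty : dualSpace.Nonempty
  primal_mono : ∀ i ∈ index, ∀ j ∈ index, le i j → primal i ⊆ primal j
  dual_anti : ∀ i ∈ index, ∀ j ∈ index, le i j → dual j ⊆ dual i
  face_mem : ∀ q ∈ primalSpace, ∀ ψ ∈ dualSpace, face q ψ ∈ index
  face_eq_iff : ∀ q ∈ primalSpace, ∀ ψ ∈ dualSpace, ∀ i ∈ index,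
    (face q ψ = i ↔ q ∈ intrinsicInterior ℝ (primal i) ∧ ψ ∈ intrinsicInterior ℝ (dual i))
  face_le : ∀ i ∈ index, ∀ q ∈ primal i, ∀ ψ ∈ intrinsicInterior ℝ (dual i), le (face q ψ) i
  le_face : ∀ i ∈ index, ∀ q ∈ intrinsicInterior ℝ (primal i), ∀ ψ ∈ dual i, le i (face q ψ)

namespace FacePairing

variable {ι E E' : Type*} [NormedAddCommGroup E] [NormedSpace ℝ E]
    [NormedAddCommGroup E'] [NormedSpace ℝ E'] (D : FacePairing ι E E')

/-- The pairing with the two families exchanged and the order of the indices reversed. -/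
def swap : FacePairing ι E' E where
  index := D.index
  le i j := D.le j i
  primal := D.dual
  dual := D.primal
  primalSpace := D.dualSpace
  dualSpace := D.primalSpace
  face ψ q := D.face q ψ
  finite := D.finite
  antisymm i hi j hj hij hji := D.antisymm i hi j hj hji hij
  primal_convex := D.dual_convex
  primal_isClosed := D.dual_isClosed
  primal_nonempty := D.dual_nonempty
  primal_subset := D.dual_subset
  dual_convex := D.primal_convex
  dual_isClosed := D.primal_isClosed
  dual_nonempty := D.primal_nonempty
  dual_subset := D.primal_subset
  primalSpace_nonempty := D.dualSpace_nonempty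
  dualSpace_nonempty := D.primalSpace_nonempty
  primal_mono i hi j hj hij := D.dual_anti j hj i hi hij
  dual_anti i hi j hj hij := D.primal_mono j hj i hi hij
  face_mem ψ hψ q hq := D.face_mem q hq ψ hψ
  face_eq_iff ψ hψ q hq i hi := (D.face_eq_iff q hq ψ hψ i hi).trans and_comm
  face_le i hi ψ hψ q hq := D.le_face i hi q hq ψ hψ
  le_face i hi ψ hψ q hq := D.face_le i hi q hq ψ hψ

/-- The cell of a point `q`: the intersection of the members of the first family that
contain `q`. -/
def cell (q : E) : Set E := ⋂₀ {C | ∃ i ∈ D.index, C = D.primal i ∧ q ∈ C}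

/-- Local coherence of a map `Ψ` that assigns a point of the dual space to each point of the
primal space. -/
def Coherent (Ψ : E → E') : Prop :=
  MapsTo Ψ D.primalSpace D.dualSpace ∧
    ∀ q ∈ D.primalSpace, ∀ p ∈ D.cell q, D.face p (Ψ q) = D.face p (Ψ p)

/-- The indices picked out by a map from the primal to the dual space. -/
def family (Ψ : E → E') : Set ι := {i | ∃ q ∈ D.primalSpace, i = D.face q (Ψ q)}

/-- The families of the locally coherent maps. -/
def coherentFamilies : Set (Set ι) := {A | ∃ Ψ, D.Coherent Ψ ∧ A = D.family Ψ}

/-- The pointwise order of the families of locally coherent maps. -/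
def FamilyLE (A B : Set ι) : Prop :=
  ∃ Ψ Φ, D.Coherent Ψ ∧ A = D.family Ψ ∧ D.Coherent Φ ∧ B = D.family Φ ∧
    ∀ q ∈ D.primalSpace, D.le (D.face q (Ψ q)) (D.face q (Φ q))

variable {D} {q p : E} {ψ φ : E'} {i j : ι} {Ψ Φ : E → E'} {A B : Set ι}

theorem mem_intrinsicInterior_primal_face (hq : q ∈ D.primalSpace) (hψ : ψ ∈ D.dualSpace) :
    q ∈ intrinsicInterior ℝ (D.primal (D.face q ψ)) :=
  ((D.face_eq_iff q hq ψ hψ _ (D.face_mem q hq ψ hψ)).1 rfl).1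

theorem mem_intrinsicInterior_dual_face (hq : q ∈ D.primalSpace) (hψ : ψ ∈ D.dualSpace) :
    ψ ∈ intrinsicInterior ℝ (D.dual (D.face q ψ)) :=
  D.swap.mem_intrinsicInterior_primal_face hψ hq

theorem mem_primal_face (hq : q ∈ D.primalSpace) (hψ : ψ ∈ D.dualSpace) :
    q ∈ D.primal (D.face q ψ) :=
  intrinsicInterior_subset (mem_intrinsicInterior_primal_face hq hψ)

theorem mem_primalSpace (hi : i ∈ D.index) (hq : q ∈ intrinsicInterior ℝ (D.primal i)) :
    q ∈ D.primalSpace :=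
  D.primal_subset i hi (intrinsicInterior_subset hq)

theorem mem_dualSpace (hi : i ∈ D.index) (hψ : ψ ∈ intrinsicInterior ℝ (D.dual i)) :
    ψ ∈ D.dualSpace :=
  D.dual_subset i hi (intrinsicInterior_subset hψ)

theorem face_eq (hi : i ∈ D.index) (hq : q ∈ intrinsicInterior ℝ (D.primal i))
    (hψ : ψ ∈ intrinsicInterior ℝ (D.dual i)) : D.face q ψ = i :=
  (D.face_eq_iff q (mem_primalSpace hi hq) ψ (mem_dualSpace hi hψ) i hi).2 ⟨hq, hψ⟩

theorem face_eq_face_of_mem_primal (hi : i ∈ D.index) (hp : p ∈ D.primal i)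
    (hψ : ψ ∈ intrinsicInterior ℝ (D.dual i)) (hφ : φ ∈ intrinsicInterior ℝ (D.dual i)) :
    D.face p ψ = D.face p φ := by
  have hpX := D.primal_subset i hi hp
  have hle : ∀ ψ φ, ψ ∈ intrinsicInterior ℝ (D.dual i) → φ ∈ intrinsicInterior ℝ (D.dual i) →
      D.le (D.face p ψ) (D.face p φ) := fun ψ φ hψ hφ => by
    have hψY := mem_dualSpace hi hψ
    have hmem := D.face_mem p hpX ψ hψY
    exact D.le_face _ hmem p (mem_intrinsicInterior_primal_face hpX hψY) φ
      (D.dual_anti _ hmem i hi (D.face_le i hi p hp ψ hψ) (intrinsicInterior_subset hφ))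
  exact D.antisymm _ (D.face_mem p hpX ψ (mem_dualSpace hi hψ)) _
    (D.face_mem p hpX φ (mem_dualSpace hi hφ)) (hle ψ φ hψ hφ) (hle φ ψ hφ hψ)

section Cells

theorem mem_cell_iff_forall : p ∈ D.cell q ↔ ∀ i ∈ D.index, q ∈ D.primal i → p ∈ D.primal i :=
  ⟨fun h i hi hqi => h _ ⟨i, hi, rfl, hqi⟩, by rintro h _ ⟨i, hi, rfl, hqi⟩; exact h i hi hqi⟩

theorem mem_cell_self (q : E) : q ∈ D.cell q := mem_sInter.2 fun _ ⟨_, _, _, hq⟩ => hq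

theorem cell_subset_cell (hp : p ∈ D.cell q) : D.cell p ⊆ D.cell q := fun _ hr =>
  mem_cell_iff_forall.2 fun i hi hqi =>
    mem_cell_iff_forall.1 hr i hi (mem_cell_iff_forall.1 hp i hi hqi)

theorem cell_subset_primalSpace (hq : q ∈ D.primalSpace) :
    D.cell q ⊆ D.primalSpace := fun p hp => by
  obtain ⟨ψ, hψ⟩ := D.dualSpace_nonempty
  have hi := D.face_mem q hq ψ hψ
  exact D.primal_subset _ hi (mem_cell_iff_forall.1 hp _ hi (mem_primal_face hq hψ))

variable [FiniteDimensional ℝ E']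

theorem intrinsicInterior_dual_nonempty (hi : i ∈ D.index) :
    (intrinsicInterior ℝ (D.dual i)).Nonempty :=
  Set.Nonempty.intrinsicInterior (D.dual_convex i hi) (D.dual_nonempty i hi)

theorem mem_cell_iff (hq : q ∈ D.primalSpace) :
    p ∈ D.cell q ↔ ∀ i ∈ D.index, q ∈ intrinsicInterior ℝ (D.primal i) → p ∈ D.primal i := by
  rw [mem_cell_iff_forall]
  refine ⟨fun h i hi hqi => h i hi (intrinsicInterior_subset hqi), fun h i hi hqi => ?_⟩
  obtain ⟨ψ, hψ⟩ := intrinsicInterior_dual_nonempty hi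
  have hψY := mem_dualSpace hi hψ
  have hmem := D.face_mem q hq ψ hψY
  exact D.primal_mono _ hmem i hi (D.face_le i hi q hqi ψ hψ)
    (h _ hmem (mem_intrinsicInterior_primal_face hq hψY))

theorem mem_cell_iff_le (hq : q ∈ D.primalSpace) (hp : p ∈ D.primalSpace) :
    p ∈ D.cell q ↔ ∀ ψ ∈ D.dualSpace, D.le (D.face p ψ) (D.face q ψ) := by
  refine ⟨fun h ψ hψ => ?_, fun h => (mem_cell_iff hq).2 fun i hi hqi => ?_⟩
  · have hmem := D.face_mem q hq ψ hψ
    exact D.face_le _ hmem p (mem_cell_iff_forall.1 h _ hmem (mem_primal_face hq hψ)) ψ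
      (mem_intrinsicInterior_dual_face hq hψ)
  · obtain ⟨ψ, hψ⟩ := intrinsicInterior_dual_nonempty hi
    have hψY := mem_dualSpace hi hψ
    have hle := h ψ hψY
    rw [face_eq hi hqi hψ] at hle
    exact D.primal_mono _ (D.face_mem p hp ψ hψY) i hi hle (mem_primal_face hp hψY)

theorem cell_subset_cell_iff (hq : q ∈ D.primalSpace) (hp : p ∈ D.primalSpace) :
    D.cell p ⊆ D.cell q ↔ ∀ ψ ∈ D.dualSpace, D.le (D.face p ψ) (D.face q ψ) := by
  rw [← mem_cell_iff_le hq hp]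
  exact ⟨fun h => h (mem_cell_self p), cell_subset_cell⟩

theorem cell_eq_biInter (hq : q ∈ D.primalSpace) :
    D.cell q =
      ⋂ i ∈ {i | i ∈ D.index ∧ q ∈ intrinsicInterior ℝ (D.primal i)}, D.primal i := by
  ext p
  simp only [mem_cell_iff hq, mem_iInter, mem_ofPred_eq, and_imp]

variable [FiniteDimensional ℝ E]

theorem mem_intrinsicInterior_cell_iff (hq : q ∈ D.primalSpace) :
    p ∈ intrinsicInterior ℝ (D.cell q) ↔
      p ∈ D.primalSpace ∧ ∀ ψ ∈ D.dualSpace, D.face p ψ = D.face q ψ := by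
  rw [cell_eq_biInter hq, mem_intrinsicInterior_biInter_iff (z := q)
    (D.finite.subset fun i hi => hi.1) (fun i hi => D.primal_convex i hi.1) (fun i hi => hi.2)]
  constructor
  · intro h
    have hface : ∀ ψ ∈ D.dualSpace, p ∈ intrinsicInterior ℝ (D.primal (D.face q ψ)) :=
      fun ψ hψ => h _ ⟨D.face_mem q hq ψ hψ, mem_intrinsicInterior_primal_face hq hψ⟩
    obtain ⟨ψ, hψ⟩ := D.dualSpace_nonempty
    exact ⟨mem_primalSpace (D.face_mem q hq ψ hψ) (hface ψ hψ), fun ψ hψ =>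
      face_eq (D.face_mem q hq ψ hψ) (hface ψ hψ) (mem_intrinsicInterior_dual_face hq hψ)⟩
  · rintro ⟨hp, h⟩ i ⟨hi, hqi⟩
    obtain ⟨ψ, hψ⟩ := intrinsicInterior_dual_nonempty hi
    have hψY := mem_dualSpace hi hψ
    have hpi := mem_intrinsicInterior_primal_face hp hψY
    rwa [h ψ hψY, face_eq hi hqi hψ] at hpi

theorem mem_intrinsicInterior_cell_self (hq : q ∈ D.primalSpace) :
    q ∈ intrinsicInterior ℝ (D.cell q) :=
  (mem_intrinsicInterior_cell_iff hq).2 ⟨hq, fun _ _ => rfl⟩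

theorem cell_eq_of_mem_intrinsicInterior (hq : q ∈ D.primalSpace)
    (hp : p ∈ intrinsicInterior ℝ (D.cell q)) : D.cell p = D.cell q := by
  refine Subset.antisymm (cell_subset_cell (intrinsicInterior_subset hp)) (cell_subset_cell ?_)
  obtain ⟨hpX, h⟩ := (mem_intrinsicInterior_cell_iff hq).1 hp
  have hpq := (mem_cell_iff_le hq hpX).1 (intrinsicInterior_subset hp)
  refine (mem_cell_iff_le hpX hq).2 fun ψ hψ => ?_
  have hle := hpq ψ hψ
  rwa [h ψ hψ] at hle ⊢

end Cells

section Coherent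

theorem coherent_const (hψ : ψ ∈ D.dualSpace) : D.Coherent fun _ => ψ :=
  ⟨fun _ _ => hψ, fun _ _ _ _ => rfl⟩

theorem coherent_iff (hΨ : MapsTo Ψ D.primalSpace D.dualSpace) :
    D.Coherent Ψ ↔ ∀ q ∈ D.primalSpace, ∀ p ∈ D.cell q,
      intrinsicInterior ℝ (D.dual (D.face q (Ψ q))) ⊆
        intrinsicInterior ℝ (D.dual (D.face p (Ψ p))) := by
  refine ⟨fun h q hq p hp φ hφ => ?_, fun h => ⟨hΨ, fun q hq p hp => ?_⟩⟩
  · have hi := D.face_mem q hq _ (hΨ hq)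
    have hpi := mem_cell_iff_forall.1 hp _ hi (mem_primal_face hq (hΨ hq))
    rw [← h.2 q hq p hp,
      face_eq_face_of_mem_primal hi hpi (mem_intrinsicInterior_dual_face hq (hΨ hq)) hφ]
    exact mem_intrinsicInterior_dual_face (cell_subset_primalSpace hq hp) (mem_dualSpace hi hφ)
  · have hpX := cell_subset_primalSpace hq hp
    exact face_eq (D.face_mem p hpX _ (hΨ hpX)) (mem_intrinsicInterior_primal_face hpX (hΨ hpX))
      (h q hq p hp (mem_intrinsicInterior_dual_face hq (hΨ hq)))

open Filter Topology in
theorem eventually_mem_cell (D : FacePairing ι E E') (p : E) : ∀ᶠ r in 𝓝 p, p ∈ D.cell r := by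
  simp only [mem_cell_iff_forall]
  refine (eventually_all_finite D.finite).2 fun i hi => ?_
  by_cases hp : p ∈ D.primal i
  · exact Eventually.of_forall fun _ _ => hp
  · filter_upwards [(D.primal_isClosed i hi).isOpen_compl.mem_nhds hp] with r hr hri
    exact absurd hri hr

-- `p ∈ cell r` for all `r` near `p`, so `r ↦ face r (Ψ r) = i` is locally constant on the
-- connected set `relint (primal i)`.
theorem Coherent.face_eq_of_mem_intrinsicInterior (h : D.Coherent Ψ) (hq : q ∈ D.primalSpace)
    (hp : p ∈ intrinsicInterior ℝ (D.primal (D.face q (Ψ q)))) :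
    D.face p (Ψ p) = D.face q (Ψ q) := by
  have hi := D.face_mem q hq _ (h.1 hq)
  set i := D.face q (Ψ q) with hiq
  have hconn : IsPreconnected (intrinsicInterior ℝ (D.primal i)) :=
    (convex_intrinsicInterior (D.primal_convex i hi)).isPreconnected
  refine (hconn.induction₂ (fun x y => D.face x (Ψ x) = i ↔ D.face y (Ψ y) = i) (fun x hx => ?_)
    (fun x y z _ _ _ h₁ h₂ => h₁.trans h₂) (fun x y _ _ h => h.symm)
    (mem_intrinsicInterior_primal_face hq (h.1 hq)) hp).1 hiq.symm
  filter_upwards [nhdsWithin_le_nhds (D.eventually_mem_cell x), self_mem_nhdsWithin] with r hxr hr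
  have hrX := mem_primalSpace hi hr
  have hxX := mem_primalSpace hi hx
  rw [← h.2 r hrX x hxr, D.face_eq_iff x hxX _ (h.1 hrX) i hi,
    D.face_eq_iff r hrX _ (h.1 hrX) i hi, and_iff_right hx, and_iff_right hr]

open Filter Topology in
theorem Coherent.exists_mem_cell (h : D.Coherent Ψ) (hq : q ∈ D.primalSpace)
    (hp : p ∈ D.primal (D.face q (Ψ q))) :
    ∃ r ∈ D.primalSpace, D.face r (Ψ r) = D.face q (Ψ q) ∧ p ∈ D.cell r := by
  have hi := D.face_mem q hq _ (h.1 hq)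
  have hlim : Tendsto (fun t : ℝ => t • q + (1 - t) • p) (𝓝[>] 0) (𝓝 p) := by
    have hcont : Continuous fun t : ℝ => t • q + (1 - t) • p := by fun_prop
    simpa only [zero_smul, sub_zero, one_smul, zero_add] using
      (hcont.tendsto 0).mono_left nhdsWithin_le_nhds
  obtain ⟨t, ht, ht_pos, ht_le⟩ := ((hlim.eventually (D.eventually_mem_cell p)).and
    (Ioc_mem_nhdsGT one_pos)).exists
  have hr := combo_intrinsicInterior_self_mem_intrinsicInterior (D.primal_convex _ hi)
    (mem_intrinsicInterior_primal_face hq (h.1 hq)) hp ht_pos (sub_nonneg.2 ht_le)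
    (add_sub_cancel t 1)
  exact ⟨_, mem_primalSpace hi hr, h.face_eq_of_mem_intrinsicInterior hq hr, ht⟩

theorem Coherent.exists_mem_intrinsicInterior_dual (h : D.Coherent Ψ) (hq : q ∈ D.primalSpace)
    (hp : p ∈ D.primal (D.face q (Ψ q))) :
    ∃ ψ, ψ ∈ intrinsicInterior ℝ (D.dual (D.face q (Ψ q))) ∧
      ψ ∈ intrinsicInterior ℝ (D.dual (D.face p (Ψ p))) := by
  obtain ⟨r, hr, hrq, hpr⟩ := h.exists_mem_cell hq hp
  refine ⟨Ψ r, hrq ▸ mem_intrinsicInterior_dual_face hr (h.1 hr), ?_⟩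
  rw [← h.2 r hr p hpr]
  exact mem_intrinsicInterior_dual_face (cell_subset_primalSpace hr hpr) (h.1 hr)

theorem Coherent.le (h : D.Coherent Ψ) (hq : q ∈ D.primalSpace)
    (hp : p ∈ D.primal (D.face q (Ψ q))) : D.le (D.face p (Ψ p)) (D.face q (Ψ q)) := by
  have hi := D.face_mem q hq _ (h.1 hq)
  obtain ⟨ψ, hψq, hψp⟩ := h.exists_mem_intrinsicInterior_dual hq hp
  have hpX := D.primal_subset _ hi hp
  have hle := D.face_le _ hi p hp ψ hψq
  rwa [face_eq (D.face_mem p hpX _ (h.1 hpX)) (mem_intrinsicInterior_primal_face hpX (h.1 hpX))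
    hψp] at hle

theorem Coherent.family_subset (h : D.Coherent Ψ) : D.family Ψ ⊆ D.index := by
  rintro _ ⟨q, hq, rfl⟩
  exact D.face_mem q hq _ (h.1 hq)

theorem Coherent.eq_face (h : D.Coherent Ψ) (hi : i ∈ D.family Ψ)
    (hq : q ∈ intrinsicInterior ℝ (D.primal i)) : i = D.face q (Ψ q) := by
  obtain ⟨p, hp, rfl⟩ := hi
  exact (h.face_eq_of_mem_intrinsicInterior hp hq).symm

theorem Coherent.face_eq_of_family_eq (hΨ : D.Coherent Ψ) (hΦ : D.Coherent Φ)
    (h : D.family Ψ = D.family Φ) (hq : q ∈ D.primalSpace) :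
    D.face q (Ψ q) = D.face q (Φ q) :=
  hΦ.eq_face (h ▸ ⟨q, hq, rfl⟩) (mem_intrinsicInterior_primal_face hq (hΨ.1 hq))

theorem familyLE_family_iff (hΨ : D.Coherent Ψ) (hΦ : D.Coherent Φ) :
    D.FamilyLE (D.family Ψ) (D.family Φ) ↔
      ∀ q ∈ D.primalSpace, D.le (D.face q (Ψ q)) (D.face q (Φ q)) := by
  refine ⟨?_, fun h => ⟨Ψ, Φ, hΨ, rfl, hΦ, rfl, h⟩⟩
  rintro ⟨Ψ', Φ', hΨ', hΨΨ', hΦ', hΦΦ', h⟩ q hq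
  rw [hΨ.face_eq_of_family_eq hΨ' hΨΨ' hq, hΦ.face_eq_of_family_eq hΦ' hΦΦ' hq]
  exact h q hq

theorem FamilyLE.antisymm (h : D.FamilyLE A B) (h' : D.FamilyLE B A) : A = B := by
  obtain ⟨Ψ, Φ, hΨ, rfl, hΦ, rfl, h⟩ := h
  rw [familyLE_family_iff hΦ hΨ] at h'
  ext i
  refine exists_congr fun q => and_congr_right fun hq => ?_
  rw [D.antisymm _ (D.face_mem q hq _ (hΨ.1 hq)) _ (D.face_mem q hq _ (hΦ.1 hq)) (h q hq)
    (h' q hq)]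

theorem family_mem_coherentFamilies (hΨ : D.Coherent Ψ) : D.family Ψ ∈ D.coherentFamilies :=
  ⟨Ψ, hΨ, rfl⟩

theorem subset_index_of_mem_coherentFamilies (hA : A ∈ D.coherentFamilies) : A ⊆ D.index := by
  obtain ⟨Ψ, hΨ, rfl⟩ := hA
  exact hΨ.family_subset

theorem exists_coherent_face_eq [FiniteDimensional ℝ E'] {i : E → ι}
    (hi : ∀ q ∈ D.primalSpace, i q ∈ D.index)
    (hq : ∀ q ∈ D.primalSpace, q ∈ intrinsicInterior ℝ (D.primal (i q)))
    (hmono : ∀ q ∈ D.primalSpace, ∀ p ∈ D.primal (i q),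
      intrinsicInterior ℝ (D.dual (i q)) ⊆ intrinsicInterior ℝ (D.dual (i p))) :
    ∃ Ψ, D.Coherent Ψ ∧ ∀ q ∈ D.primalSpace, D.face q (Ψ q) = i q := by
  choose! Ψ hΨ using fun q hqX => intrinsicInterior_dual_nonempty (hi q hqX)
  have hface : ∀ q ∈ D.primalSpace, D.face q (Ψ q) = i q := fun q hqX =>
    face_eq (hi q hqX) (hq q hqX) (hΨ q hqX)
  refine ⟨Ψ, ⟨fun q hqX => mem_dualSpace (hi q hqX) (hΨ q hqX), fun q hqX p hp => ?_⟩, hface⟩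
  have hpX := cell_subset_primalSpace hqX hp
  have hpq := mem_cell_iff_forall.1 hp (i q) (hi q hqX) (intrinsicInterior_subset (hq q hqX))
  rw [hface p hpX]
  exact face_eq (hi p hpX) (hq p hpX) (hmono q hqX p hpq (hΨ q hqX))

end Coherent

section CellMaps

variable {𝒞 : Set (Set E)} {Θ Θ' : 𝒞 → E'}

variable (D) in
/-- Local coherence of a map `Θ` that assigns a point of the dual space to each cell. -/
def CellCoherent (Θ : 𝒞 → E') : Prop :=
  (∀ c, Θ c ∈ D.dualSpace) ∧
    ∀ c c' : 𝒞, (c' : Set E) ⊆ c →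
      ∀ q ∈ intrinsicInterior ℝ (c : Set E), ∀ q' ∈ intrinsicInterior ℝ (c' : Set E),
        intrinsicInterior ℝ (D.dual (D.face q (Θ c))) ⊆
          intrinsicInterior ℝ (D.dual (D.face q' (Θ c')))

variable (D) in
/-- The indices picked out by a map from the cells to the dual space. -/
def cellFamily (Θ : 𝒞 → E') : Set ι :=
  {i | ∃ c : 𝒞, ∃ q ∈ intrinsicInterior ℝ (c : Set E), i = D.face q (Θ c)}

variable (D) in
/-- The map `Θ` on cells and the map `Ψ` on points pick out the same index at each point. -/
def AgreeOnCells (Θ : 𝒞 → E') (Ψ : E → E') : Prop :=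
  ∀ c : 𝒞, ∀ q ∈ intrinsicInterior ℝ (c : Set E), D.face q (Θ c) = D.face q (Ψ q)

variable [FiniteDimensional ℝ E] [FiniteDimensional ℝ E']

theorem cell_eq_of_mem_cells {c : Set E} (hc : c ∈ D.cell '' D.primalSpace)
    (hq : q ∈ intrinsicInterior ℝ c) : q ∈ D.primalSpace ∧ D.cell q = c := by
  obtain ⟨p, hp, rfl⟩ := hc
  exact ⟨cell_subset_primalSpace hp (intrinsicInterior_subset hq),
    cell_eq_of_mem_intrinsicInterior hp hq⟩

theorem family_const_eq_of_mem_intrinsicInterior (hφ : φ ∈ D.dualSpace)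
    (hψ : ψ ∈ intrinsicInterior ℝ (D.swap.cell φ)) :
    D.family (fun _ => ψ) = D.family fun _ => φ := by
  have hface := ((D.swap.mem_intrinsicInterior_cell_iff hφ).1 hψ).2
  ext i
  refine exists_congr fun q => and_congr_right fun hq => ?_
  have hq_face : D.face q ψ = D.face q φ := hface q hq
  rw [hq_face]

variable (h𝒞 : 𝒞 = D.cell '' D.primalSpace)
include h𝒞

theorem AgreeOnCells.cellFamily_eq (h : D.AgreeOnCells Θ Ψ) : D.cellFamily Θ = D.family Ψ := by
  subst h𝒞
  ext i
  constructor
  · rintro ⟨c, q, hq, rfl⟩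
    exact ⟨q, (cell_eq_of_mem_cells c.2 hq).1, h c q hq⟩
  · rintro ⟨q, hq, rfl⟩
    have hqc := mem_intrinsicInterior_cell_self hq
    exact ⟨⟨_, mem_image_of_mem _ hq⟩, q, hqc, (h ⟨_, mem_image_of_mem _ hq⟩ q hqc).symm⟩

theorem cellFamily_const (ψ : E') : D.cellFamily (fun _ : 𝒞 => ψ) = D.family fun _ => ψ :=
  AgreeOnCells.cellFamily_eq h𝒞 fun _ _ _ => rfl

theorem AgreeOnCells.cellCoherent_iff (h : D.AgreeOnCells Θ Ψ) (hΘ : ∀ c, Θ c ∈ D.dualSpace)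
    (hΨ : MapsTo Ψ D.primalSpace D.dualSpace) : D.CellCoherent Θ ↔ D.Coherent Ψ := by
  subst h𝒞
  rw [coherent_iff hΨ, CellCoherent, and_iff_right hΘ]
  constructor
  · intro hcoh q hq p hp
    have hpX := cell_subset_primalSpace hq hp
    have hqc := mem_intrinsicInterior_cell_self hq
    have hpc := mem_intrinsicInterior_cell_self hpX
    rw [← h ⟨_, mem_image_of_mem _ hq⟩ q hqc, ← h ⟨_, mem_image_of_mem _ hpX⟩ p hpc]
    exact hcoh _ _ (cell_subset_cell hp) q hqc p hpc
  · intro hcoh c c' hcc' q hq p hp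
    obtain ⟨hqX, hqc⟩ := cell_eq_of_mem_cells c.2 hq
    rw [h c q hq, h c' p hp]
    exact hcoh q hqX p (hqc ▸ hcc' (intrinsicInterior_subset hp))

theorem CellCoherent.exists_agreeOnCells (hΘ : D.CellCoherent Θ) :
    ∃ Ψ, D.Coherent Ψ ∧ D.AgreeOnCells Θ Ψ := by
  classical
  obtain ⟨ψ, -⟩ := D.dualSpace_nonempty
  let Ψ : E → E' := fun q => if hq : D.cell q ∈ 𝒞 then Θ ⟨D.cell q, hq⟩ else ψ
  have hΨ : D.AgreeOnCells Θ Ψ := fun c q hq => by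
    obtain ⟨-, hqc⟩ := cell_eq_of_mem_cells (D := D) (h𝒞.le c.2) hq
    simp only [Ψ, hqc, c.2, dif_pos]
  refine ⟨Ψ, (hΨ.cellCoherent_iff h𝒞 hΘ.1 fun q hq => ?_).1 hΘ, hΨ⟩
  have hqc : D.cell q ∈ 𝒞 := h𝒞.ge (mem_image_of_mem _ hq)
  simpa only [Ψ, hqc, dif_pos] using hΘ.1 _

theorem Coherent.exists_agreeOnCells (hΨ : D.Coherent Ψ) :
    ∃ Θ : 𝒞 → E', D.CellCoherent Θ ∧ D.AgreeOnCells Θ Ψ := by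
  subst h𝒞
  choose r hr hrc using fun c : D.cell '' D.primalSpace => c.2
  have hΘ : D.AgreeOnCells (fun c => Ψ (r c)) Ψ := fun c q hq =>
    hΨ.2 _ (hr c) q ((hrc c).symm ▸ intrinsicInterior_subset hq)
  exact ⟨_, (hΘ.cellCoherent_iff rfl (fun c => hΨ.1 (hr c)) hΨ.1).2 hΨ, hΘ⟩

theorem mem_coherentFamilies_iff :
    A ∈ D.coherentFamilies ↔ ∃ Θ : 𝒞 → E', D.CellCoherent Θ ∧ A = D.cellFamily Θ := by
  constructor
  · rintro ⟨Ψ, hΨ, rfl⟩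
    obtain ⟨Θ, hΘ, h⟩ := hΨ.exists_agreeOnCells h𝒞
    exact ⟨Θ, hΘ, (h.cellFamily_eq h𝒞).symm⟩
  · rintro ⟨Θ, hΘ, rfl⟩
    obtain ⟨Ψ, hΨ, h⟩ := hΘ.exists_agreeOnCells h𝒞
    exact ⟨Ψ, hΨ, h.cellFamily_eq h𝒞⟩

theorem familyLE_iff :
    D.FamilyLE A B ↔ ∃ Θ Θ' : 𝒞 → E', D.CellCoherent Θ ∧ A = D.cellFamily Θ ∧
      D.CellCoherent Θ' ∧ B = D.cellFamily Θ' ∧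
      ∀ c : 𝒞, ∀ q ∈ intrinsicInterior ℝ (c : Set E),
        D.le (D.face q (Θ c)) (D.face q (Θ' c)) := by
  constructor
  · rintro ⟨Ψ, Φ, hΨ, rfl, hΦ, rfl, hle⟩
    obtain ⟨Θ, hΘ, hΘΨ⟩ := hΨ.exists_agreeOnCells h𝒞
    obtain ⟨Θ', hΘ', hΘΦ⟩ := hΦ.exists_agreeOnCells h𝒞
    refine ⟨Θ, Θ', hΘ, (hΘΨ.cellFamily_eq h𝒞).symm, hΘ', (hΘΦ.cellFamily_eq h𝒞).symm,
      fun c q hq => ?_⟩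
    rw [hΘΨ c q hq, hΘΦ c q hq]
    exact hle q (cell_eq_of_mem_cells (h𝒞.le c.2) hq).1
  · rintro ⟨Θ, Θ', hΘ, rfl, hΘ', rfl, hle⟩
    obtain ⟨Ψ, hΨ, hΘΨ⟩ := hΘ.exists_agreeOnCells h𝒞
    obtain ⟨Φ, hΦ, hΘΦ⟩ := hΘ'.exists_agreeOnCells h𝒞
    refine ⟨Ψ, Φ, hΨ, hΘΨ.cellFamily_eq h𝒞, hΦ, hΘΦ.cellFamily_eq h𝒞, fun q hq => ?_⟩
    have hqc : D.cell q ∈ 𝒞 := h𝒞.ge (mem_image_of_mem _ hq)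
    have hqi := mem_intrinsicInterior_cell_self hq
    rw [← hΘΨ ⟨_, hqc⟩ q hqi, ← hΘΦ ⟨_, hqc⟩ q hqi]
    exact hle ⟨_, hqc⟩ q hqi

end CellMaps

section ConstantMaps

variable [FiniteDimensional ℝ E]

theorem familyLE_family_const_iff (hφ : φ ∈ D.dualSpace) (hψ : ψ ∈ D.dualSpace) :
    (D.FamilyLE (D.family fun _ => φ) (D.family fun _ => ψ)) ↔
      D.swap.cell ψ ⊆ D.swap.cell φ :=
  (familyLE_family_iff (coherent_const hφ) (coherent_const hψ)).trans
    (D.swap.cell_subset_cell_iff hφ hψ).symm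

variable (D) in
/-- The family of the constant maps with a value in the relative interior of `σ`. They all have
the same family if `σ` is a cell of the dual space. -/
def familyOfDualCell (σ : Set E') : Set ι :=
  ⋃ ψ ∈ intrinsicInterior ℝ σ, D.family fun _ => ψ

variable [FiniteDimensional ℝ E']

theorem familyOfDualCell_cell (hφ : φ ∈ D.dualSpace) :
    D.familyOfDualCell (D.swap.cell φ) = D.family fun _ => φ := by
  refine Subset.antisymm (iUnion₂_subset fun ψ hψ => ?_)
    (subset_iUnion₂_of_subset φ (D.swap.mem_intrinsicInterior_cell_self hφ) subset_rfl)
  exact (family_const_eq_of_mem_intrinsicInterior hφ hψ).subset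

variable (D) in
theorem isEmbeddingOn_familyOfDualCell :
    IsEmbeddingOn D.familyOfDualCell (D.swap.cell '' D.dualSpace) (· ⊆ ·) D.coherentFamilies
      (flip D.FamilyLE) := by
  have hle : ∀ σ ∈ D.swap.cell '' D.dualSpace, ∀ τ ∈ D.swap.cell '' D.dualSpace,
      (σ ⊆ τ ↔ D.FamilyLE (D.familyOfDualCell τ) (D.familyOfDualCell σ)) := by
    rintro _ ⟨ψ, hψ, rfl⟩ _ ⟨φ, hφ, rfl⟩
    rw [familyOfDualCell_cell hψ, familyOfDualCell_cell hφ, familyLE_family_const_iff hφ hψ]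
  refine ⟨?_, fun σ hσ τ hτ h => Subset.antisymm ?_ ?_, hle⟩
  · rintro _ ⟨ψ, hψ, rfl⟩
    rw [familyOfDualCell_cell hψ]
    exact family_mem_coherentFamilies (coherent_const hψ)
  · exact (hle σ hσ τ hτ).2 (h ▸ (hle σ hσ σ hσ).1 subset_rfl)
  · exact (hle τ hτ σ hσ).2 (h ▸ (hle σ hσ σ hσ).1 subset_rfl)

end ConstantMaps

end FacePairing

section Fibers

variable {V W : Type*} [NormedAddCommGroup V] [NormedSpace ℝ V]
  [NormedAddCommGroup W] [NormedSpace ℝ W]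
  {P F : Set V} {π : V →L[ℝ] W} {q : W} {ψ : KerDual π} {x : V} {l m : V →L[ℝ] ℝ}

/-- `π^∨` as a linear map. -/
def dualProjₗ (π : V →L[ℝ] W) : (V →L[ℝ] ℝ) →ₗ[ℝ] KerDual π where
  toFun := dualProj π
  map_add' _ _ := rfl
  map_smul' _ _ := rfl

theorem dualProj_apply (k : LinearMap.ker π.toLinearMap) : dualProj π l k = l k := rfl

theorem map_add_ker (k : LinearMap.ker π.toLinearMap) : π (x + k) = π x := by
  have hk : π (k : V) = 0 := k.2
  rw [map_add, hk, add_zero]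

theorem fiberFace_eq_toExposed : fiberFace P π q (dualProj π l) = l.toExposed (P ∩ π ⁻¹' {q}) := by
  ext x
  constructor
  · rintro ⟨hx, rfl, hmax⟩
    refine ⟨⟨hx, rfl⟩, fun y ⟨hy, hyx⟩ => ?_⟩
    have hk : y - x ∈ LinearMap.ker π.toLinearMap := LinearMap.sub_mem_ker_iff.2 hyx
    have hle := hmax ⟨y - x, hk⟩ (by rwa [add_sub_cancel])
    rwa [dualProj_apply, map_sub, sub_nonpos] at hle
  · rintro ⟨⟨hx, hxq⟩, hmax⟩
    refine ⟨hx, hxq, fun k hk => ?_⟩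
    have hle := hmax (x + k) ⟨hk, (map_add_ker k).trans hxq⟩
    rwa [map_add, add_le_iff_nonpos_right] at hle

theorem inter_fiber_subset_fiberFace (hl : l ∈ normalCone P F) :
    F ∩ π ⁻¹' {q} ⊆ fiberFace P π q (dualProj π l) := by
  rw [fiberFace_eq_toExposed]
  exact fun x ⟨hx, hxq⟩ => ⟨⟨(hl hx).1, hxq⟩, fun y hy => (hl hx).2 y hy.1⟩

theorem fiberFace_eq_inter (hl : l.toExposed P = F) (hq : q ∈ π '' F) :
    fiberFace P π q (dualProj π l) = F ∩ π ⁻¹' {q} := by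
  refine Subset.antisymm ?_ (inter_fiber_subset_fiberFace hl.ge)
  rw [fiberFace_eq_toExposed]
  obtain ⟨x, hx, hxq⟩ := hq
  rintro y ⟨⟨hy, hyq⟩, hmax⟩
  subst hl
  exact ⟨mem_toExposed_of_le hx hy (hmax x ⟨hx.1, hxq⟩), hyq⟩

theorem fiberFace_subset : fiberFace P π q ψ ⊆ P := fun _ hx => hx.1

theorem fiberFace_subset_minFace : fiberFace P π q ψ ⊆ minFace P π q ψ :=
  subset_sInter fun _ hF => hF.2

theorem minFace_subset (hF : IsFace P F) (h : fiberFace P π q ψ ⊆ F) : minFace P π q ψ ⊆ F :=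
  sInter_subset_of_mem ⟨hF, h⟩

theorem add_mem_fiberFace {k : LinearMap.ker π.toLinearMap} (hx : x ∈ fiberFace P π q ψ)
    (hk : x + (k : V) ∈ P) (hψk : ψ k = 0) : x + (k : V) ∈ fiberFace P π q ψ := by
  refine ⟨hk, (map_add_ker k).trans hx.2.1, fun k' hk' => ?_⟩
  have hle := hx.2.2 (k + k') (by rwa [add_assoc] at hk')
  rwa [map_add, hψk, zero_add] at hle

theorem IsFace.intrinsicInterior_image [FiniteDimensional ℝ V] [FiniteDimensional ℝ W]
    (hP : Convex ℝ P) (hF : IsFace P F) :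
    intrinsicInterior ℝ (π '' F) = π '' intrinsicInterior ℝ F :=
  intrinsicInterior_linearMap_image π.toLinearMap (hF.convex hP)

variable [FiniteDimensional ℝ V]

theorem dualProj_surjective : Function.Surjective (dualProj π) := fun ψ => by
  obtain ⟨g, hg⟩ := LinearMap.exists_extend ψ.toLinearMap
  refine ⟨LinearMap.toContinuousLinearMap g, ?_⟩
  ext k
  exact LinearMap.congr_fun hg k

theorem intrinsicInterior_dualProj_image :
    intrinsicInterior ℝ (dualProj π '' normalCone P F) =
      dualProj π '' intrinsicInterior ℝ (normalCone P F) :=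
  intrinsicInterior_linearMap_image (E := V →L[ℝ] ℝ) (E' := KerDual π) (dualProjₗ π)
    convex_normalCone

variable (hP : IsPolytope P)
include hP

theorem fiberFace_nonempty (hq : q ∈ π '' P) : (fiberFace P π q ψ).Nonempty := by
  obtain ⟨l, rfl⟩ := dualProj_surjective ψ
  rw [fiberFace_eq_toExposed]
  obtain ⟨x, hx, hxq⟩ := hq
  have hcompact : IsCompact (P ∩ π ⁻¹' {q}) :=
    hP.isCompact.inter_right (isClosed_singleton.preimage π.continuous)
  obtain ⟨y, hy, hmax⟩ := hcompact.exists_isMaxOn ⟨x, hx, hxq⟩ l.continuous.continuousOn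
  exact ⟨y, hy, hmax⟩

theorem convex_fiberFace : Convex ℝ (fiberFace P π q ψ) := by
  obtain ⟨l, rfl⟩ := dualProj_surjective ψ
  rw [fiberFace_eq_toExposed]
  exact ContinuousLinearMap.toExposed.isExposed.convex
    (hP.convex.inter ((convex_singleton q).linear_preimage π.toLinearMap))

theorem isFace_minFace (hq : q ∈ π '' P) : IsFace P (minFace P π q ψ) :=
  isFace_sInter_faces hP (fiberFace_nonempty hP hq) fiberFace_subset

theorem exists_mem_fiberFace_mem_intrinsicInterior_minFace (hq : q ∈ π '' P) :
    ∃ x ∈ fiberFace P π q ψ, x ∈ intrinsicInterior ℝ (minFace P π q ψ) := by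
  obtain ⟨x, hx⟩ := Set.Nonempty.intrinsicInterior (convex_fiberFace hP (ψ := ψ))
    (fiberFace_nonempty hP hq)
  have hxf := intrinsicInterior_subset hx
  refine ⟨x, hxf, ((isFace_minFace hP hq).mem_intrinsicInterior_iff hP).2
    ⟨fiberFace_subset_minFace hxf, fun G hG hxG =>
      minFace_subset hG (hG.subset_of_mem_intrinsicInterior fiberFace_subset hx hxG)⟩⟩

theorem isPolyhedralCone_dualProj_image (π : V →L[ℝ] W) (hF : IsFace P F) :
    IsPolyhedralCone (dualProj π '' normalCone P F) := by
  obtain ⟨K, hK, hKN⟩ := hF.isPolyhedralCone_normalCone hP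
  refine ⟨K.map (dualProjₗ π), Submodule.FG.map _ hK, ?_⟩
  rw [PointedCone.coe_map, hKN]
  rfl

theorem mem_intrinsicInterior_dualProj_image_iff (hF : IsFace P F) :
    ψ ∈ intrinsicInterior ℝ (dualProj π '' normalCone P F) ↔
      ∃ l, l.toExposed P = F ∧ dualProj π l = ψ := by
  rw [intrinsicInterior_dualProj_image]
  exact exists_congr fun l => and_congr_left fun _ =>
    hF.mem_intrinsicInterior_normalCone_iff hP

theorem exists_add_smul_ker_mem (hF : IsFace P F) (hx : x ∈ intrinsicInterior ℝ F)
    {k : LinearMap.ker π.toLinearMap} (hk : ∀ φ ∈ dualProj π '' normalCone P F, 0 ≤ φ k) :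
    ∃ ε > (0 : ℝ), x + ((ε • -k : LinearMap.ker π.toLinearMap) : V) ∈ P :=
  hF.exists_add_smul_mem hP hx (v := -(k : V)) fun l hl => by
    rw [map_neg, Left.neg_nonpos_iff]
    exact hk _ (mem_image_of_mem _ hl)

theorem mem_dualProj_normalCone_minFace (hq : q ∈ π '' P) :
    ψ ∈ dualProj π '' normalCone P (minFace P π q ψ) := by
  obtain ⟨x, hx, hxF⟩ := exists_mem_fiberFace_mem_intrinsicInterior_minFace hP (ψ := ψ) hq
  have hF : IsFace P (minFace P π q ψ) := isFace_minFace hP hq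
  obtain ⟨K, hK, hKN⟩ := isPolyhedralCone_dualProj_image hP π hF
  by_contra hψ
  rw [← hKN] at hψ
  obtain ⟨k, hk, hkψ⟩ := exists_neg_of_notMem_of_fg
    (p := (topDualPairing ℝ (LinearMap.ker π.toLinearMap)).flip) hK hψ
  simp only [LinearMap.flip_apply, topDualPairing_apply] at hk hkψ
  obtain ⟨ε, hε, hmem⟩ := exists_add_smul_ker_mem hP hF hxF fun φ hφ => hk φ (hKN.ge hφ)
  have hle := hx.2.2 _ hmem
  rw [map_smul, map_neg, smul_eq_mul] at hle
  exact hle.not_gt (mul_pos hε (neg_pos.2 hkψ))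

-- Strict complementarity: if `ψ` were on the boundary of the cone, a supporting hyperplane would
-- give a direction in `ker π` in which one can leave `minFace` without leaving `fiberFace`.
theorem mem_intrinsicInterior_dualProj_normalCone_minFace (hq : q ∈ π '' P) :
    ψ ∈ intrinsicInterior ℝ (dualProj π '' normalCone P (minFace P π q ψ)) := by
  obtain ⟨x, hx, hxF⟩ := exists_mem_fiberFace_mem_intrinsicInterior_minFace hP (ψ := ψ) hq
  have hF : IsFace P (minFace P π q ψ) := isFace_minFace hP hq
  obtain ⟨K, hK, hKN⟩ := isPolyhedralCone_dualProj_image hP π hF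
  by_contra hψ
  have hψK : ψ ∈ K := hKN.ge (mem_dualProj_normalCone_minFace hP hq)
  rw [← hKN] at hψ
  obtain ⟨k, hk, hkψ, φ, hφ, hkφ⟩ := exists_supporting_of_notMem_intrinsicInterior
    (topDualPairing ℝ (LinearMap.ker π.toLinearMap)).flip hK hψK hψ
  simp only [LinearMap.flip_apply, topDualPairing_apply] at hk hkψ hkφ
  obtain ⟨ε, hε, hmem⟩ := exists_add_smul_ker_mem hP hF hxF fun φ hφ => hk φ (hKN.ge hφ)
  have hy := add_mem_fiberFace hx hmem (by rw [map_smul, map_neg, hkψ, neg_zero, smul_zero])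
  obtain ⟨m, hm, rfl⟩ := hKN.le hφ
  have hle := (hm (fiberFace_subset_minFace hy)).2 x hx.1
  rw [map_add, le_add_iff_nonneg_right, ← dualProj_apply, map_smul, map_neg, smul_eq_mul] at hle
  exact hle.not_gt (mul_neg_of_pos_of_neg hε (neg_neg_of_pos hkφ))

theorem minFace_subset_of_mem_intrinsicInterior (hF : IsFace P F) (hq : q ∈ π '' F)
    (hψ : ψ ∈ intrinsicInterior ℝ (dualProj π '' normalCone P F)) : minFace P π q ψ ⊆ F := by
  obtain ⟨l, hl, rfl⟩ := (mem_intrinsicInterior_dualProj_image_iff hP hF).1 hψ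
  refine minFace_subset hF ?_
  rw [fiberFace_eq_inter hl hq]
  exact inter_subset_left

variable [FiniteDimensional ℝ W]

theorem mem_intrinsicInterior_image_minFace (hq : q ∈ π '' P) :
    q ∈ intrinsicInterior ℝ (π '' minFace P π q ψ) := by
  obtain ⟨x, hx, hxF⟩ := exists_mem_fiberFace_mem_intrinsicInterior_minFace hP (ψ := ψ) hq
  rw [(isFace_minFace hP hq).intrinsicInterior_image hP.convex]
  exact ⟨x, hxF, hx.2.1⟩

theorem subset_minFace_of_mem_intrinsicInterior (hF : IsFace P F)
    (hq : q ∈ intrinsicInterior ℝ (π '' F)) (hψ : ψ ∈ dualProj π '' normalCone P F) :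
    F ⊆ minFace P π q ψ := by
  rw [hF.intrinsicInterior_image hP.convex] at hq
  obtain ⟨x, hx, rfl⟩ := hq
  obtain ⟨l, hl, rfl⟩ := hψ
  have hxF := intrinsicInterior_subset hx
  exact ((hF.mem_intrinsicInterior_iff hP).1 hx).2 _
    (isFace_minFace hP (mem_image_of_mem π (hF.subset hxF)))
    (fiberFace_subset_minFace (inter_fiber_subset_fiberFace hl ⟨hxF, rfl⟩))

theorem fiberFace_eq_minFace_inter (hq : q ∈ π '' P) :
    fiberFace P π q ψ = minFace P π q ψ ∩ π ⁻¹' {q} := by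
  obtain ⟨l, hl, hlψ⟩ := (mem_intrinsicInterior_dualProj_image_iff hP (isFace_minFace hP hq)).1
    (mem_intrinsicInterior_dualProj_normalCone_minFace hP (ψ := ψ) hq)
  have heq := fiberFace_eq_inter hl (intrinsicInterior_subset
    (mem_intrinsicInterior_image_minFace hP hq))
  rwa [hlψ] at heq

variable (π) in
/-- The families `π(F)` and `π^∨ N(P, F)`, indexed by the faces `F` of `P`. -/
def facePairing : FacePairing (Set V) W (KerDual π) where
  index := faces P
  le := (· ⊆ ·)
  primal F := π '' F
  dual F := dualProj π '' normalCone P F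
  primalSpace := π '' P
  dualSpace := univ
  face := minFace P π
  finite := finite_faces hP
  antisymm _ _ _ _ := Subset.antisymm
  primal_convex _ hF := (IsFace.convex hP.convex hF).linear_image π.toLinearMap
  primal_isClosed _ hF := ((IsFace.isCompact hP.isCompact hF).image π.continuous).isClosed
  primal_nonempty _ hF := hF.1.image _
  primal_subset _ hF := image_mono (IsFace.subset hF)
  dual_convex _ _ := convex_normalCone.linear_image (dualProjₗ π)
  dual_isClosed F hF := by
    obtain ⟨K, hK, hKN⟩ := isPolyhedralCone_dualProj_image hP π hF
    exact hKN ▸ isClosed_of_fg hK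
  dual_nonempty F hF := by
    obtain ⟨_, l, rfl⟩ := hF
    exact ⟨_, l, subset_refl (l.toExposed P), rfl⟩
  dual_subset _ _ := subset_univ _
  primalSpace_nonempty := hP.nonempty.image _
  dualSpace_nonempty := univ_nonempty
  primal_mono _ _ _ _ := image_mono
  dual_anti _ _ _ _ h := image_mono (normalCone_anti h)
  face_mem _ hq _ _ := isFace_minFace hP hq
  face_eq_iff q hq ψ _ F hF := by
    refine ⟨?_, fun ⟨hqF, hψF⟩ => Subset.antisymm
      (minFace_subset_of_mem_intrinsicInterior hP hF (intrinsicInterior_subset hqF) hψF)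
      (subset_minFace_of_mem_intrinsicInterior hP hF hqF (intrinsicInterior_subset hψF))⟩
    rintro rfl
    exact ⟨mem_intrinsicInterior_image_minFace hP hq,
      mem_intrinsicInterior_dualProj_normalCone_minFace hP hq⟩
  face_le _ hF _ hq _ hψ := minFace_subset_of_mem_intrinsicInterior hP hF hq hψ
  le_face _ hF _ hq _ hψ := subset_minFace_of_mem_intrinsicInterior hP hF hq hψ

end Fibers

section Translation

variable {V W : Type*} [NormedAddCommGroup V] [NormedSpace ℝ V]
  [NormedAddCommGroup W] [NormedSpace ℝ W]
  {P F : Set V} {π : V →L[ℝ] W} {q : W} {ψ : KerDual π} {l : V →L[ℝ] ℝ} {A B : Set (Set V)}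

theorem conesOf_stringOf (Ψ : cells P π → KerDual π) :
    conesOf P (stringOf P π Ψ) = virtualConeOf P π Ψ := by
  ext C
  constructor
  · rintro ⟨_, ⟨c, q, hq, rfl⟩, rfl⟩
    exact ⟨c, q, hq, rfl⟩
  · rintro ⟨c, q, hq, rfl⟩
    exact ⟨_, ⟨c, q, hq, rfl⟩, rfl⟩

theorem virtualCones_eq_image : virtualCones P π = conesOf P '' strings P π := by
  ext C
  constructor
  · rintro ⟨Ψ, hΨ, rfl⟩
    exact ⟨_, ⟨Ψ, hΨ, rfl⟩, conesOf_stringOf Ψ⟩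
  · rintro ⟨_, ⟨Ψ, hΨ, rfl⟩, rfl⟩
    exact ⟨Ψ, hΨ, conesOf_stringOf Ψ⟩

theorem injOn_conesOf : InjOn (conesOf P) {A | A ⊆ faces P} := fun _ hA _ hB h =>
  (injOn_normalCone.image_eq_image_iff hA hB).1 h

variable [FiniteDimensional ℝ V] [FiniteDimensional ℝ W] (hP : IsPolytope P)
include hP

theorem fiberConeOf_eq (hq : q ∈ π '' P) :
    fiberConeOf P π q ψ = dualProj π '' normalCone P (minFace P π q ψ) := by
  refine Subset.antisymm (fun φ hφ => ?_) ?_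
  · have hψφ : fiberFace P π q ψ ⊆ fiberFace P π q φ :=
      hφ _ ⟨⟨ψ, rfl⟩, subset_refl (fiberFace P π q ψ)⟩
    exact image_mono (normalCone_anti (minFace_subset (isFace_minFace hP hq)
      (hψφ.trans fiberFace_subset_minFace))) (mem_dualProj_normalCone_minFace hP hq)
  · rintro _ ⟨m, hm, rfl⟩ _ ⟨⟨ψ', rfl⟩, hψ'⟩
    have hψ'ψ : fiberFace P π q ψ' ⊆ fiberFace P π q ψ := hψ'
    rw [fiberFace_eq_minFace_inter hP (ψ := ψ) hq] at hψ'ψ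
    exact hψ'ψ.trans (inter_fiber_subset_fiberFace hm)

theorem coherentString_eq_family :
    coherentString P π ψ = (facePairing π hP).family fun _ => ψ :=
  FacePairing.cellFamily_const (D := facePairing π hP) rfl ψ

theorem stringCellOf_eq (hq : q ∈ π '' P) : stringCellOf P π q ψ = π '' minFace P π q ψ := by
  have hqF := intrinsicInterior_subset (mem_intrinsicInterior_image_minFace hP (ψ := ψ) hq)
  refine Subset.antisymm (sInter_subset_of_mem ⟨_, ?_, rfl, hqF⟩) (subset_sInter ?_)
  · rw [coherentString_eq_family hP]
    exact ⟨q, hq, rfl⟩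
  · rintro _ ⟨F, hF, rfl, hqF⟩
    rw [coherentString_eq_family hP] at hF
    obtain ⟨p, hp, rfl⟩ := hF
    exact image_mono (minFace_subset_of_mem_intrinsicInterior hP (isFace_minFace hP hp) hqF
      (mem_intrinsicInterior_dualProj_normalCone_minFace hP hp))

theorem mem_image_of_mem_cells {c : Set W} (hc : c ∈ cells P π)
    (hq : q ∈ intrinsicInterior ℝ c) : q ∈ π '' P :=
  (FacePairing.cell_eq_of_mem_cells (D := facePairing π hP) hc hq).1

theorem isCoherentOnCells_iff {Ψ : cells P π → KerDual π} :
    IsCoherentOnCells P π Ψ ↔ (facePairing π hP).CellCoherent Ψ := by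
  refine Iff.trans ?_ (and_iff_right fun _ => mem_univ _).symm
  refine forall₅_congr fun c c' _ q hq => forall₂_congr fun q' hq' => ?_
  rw [fiberConeOf_eq hP (mem_image_of_mem_cells hP c.2 hq),
    fiberConeOf_eq hP (mem_image_of_mem_cells hP c'.2 hq')]
  rfl

theorem isCoherentOnCones_iff {κ : cones P π → π '' P} :
    IsCoherentOnCones P π κ ↔ (facePairing π hP).swap.CellCoherent fun σ => (κ σ : W) := by
  refine Iff.trans ?_ (and_iff_right fun σ => (κ σ).2).symm
  simp only [IsCoherentOnCones, stringCellOf_eq hP (Subtype.coe_prop _)]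
  rfl

theorem cones_eq_image_cell :
    cones P π = (facePairing π hP).swap.cell '' (facePairing π hP).swap.primalSpace :=
  image_univ.symm

theorem strings_eq_coherentFamilies : strings P π = (facePairing π hP).coherentFamilies := by
  ext A
  simp only [strings, mem_ofPred_eq, isCoherentOnCells_iff hP]
  exact (FacePairing.mem_coherentFamilies_iff (D := facePairing π hP) rfl).symm

theorem virtualCells_eq_coherentFamilies :
    virtualCells P π = (facePairing π hP).swap.coherentFamilies := by
  ext A
  simp only [virtualCells, mem_ofPred_eq, isCoherentOnCones_iff hP]
  rw [FacePairing.mem_coherentFamilies_iff (D := (facePairing π hP).swap)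
    (cones_eq_image_cell hP)]
  constructor
  · rintro ⟨κ, hκ, rfl⟩
    exact ⟨_, hκ, rfl⟩
  · rintro ⟨Θ, hΘ, rfl⟩
    exact ⟨fun σ => ⟨Θ σ, hΘ.1 σ⟩, hΘ, rfl⟩

theorem subset_faces_of_mem_strings (hA : A ∈ strings P π) : A ⊆ faces P := by
  rw [strings_eq_coherentFamilies hP] at hA
  exact FacePairing.subset_index_of_mem_coherentFamilies hA

theorem subset_faces_of_mem_virtualCells (hA : A ∈ virtualCells P π) : A ⊆ faces P := by
  rw [virtualCells_eq_coherentFamilies hP] at hA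
  exact FacePairing.subset_index_of_mem_coherentFamilies hA

theorem virtualConeLE_conesOf_iff (hA : A ∈ strings P π) (hB : B ∈ strings P π) :
    VirtualConeLE P π (conesOf P A) (conesOf P B) ↔ (facePairing π hP).FamilyLE B A := by
  have hcones : ∀ {A}, A ∈ strings P π → ∀ {Ψ}, IsCoherentOnCells P π Ψ →
      (conesOf P A = virtualConeOf P π Ψ ↔ A = stringOf P π Ψ) := fun {A} hA {Ψ} hΨ => by
    rw [← conesOf_stringOf]
    exact injOn_conesOf.eq_iff (subset_faces_of_mem_strings hP hA)
      (subset_faces_of_mem_strings hP ⟨Ψ, hΨ, rfl⟩)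
  rw [FacePairing.familyLE_iff (D := facePairing π hP) (𝒞 := cells P π) rfl]
  constructor
  · rintro ⟨Ψ, Φ, hΨ, hAΨ, hΦ, hBΦ, hle⟩
    refine ⟨Φ, Ψ, (isCoherentOnCells_iff hP).1 hΦ, (hcones hB hΦ).1 hBΦ,
      (isCoherentOnCells_iff hP).1 hΨ, (hcones hA hΨ).1 hAΨ, fun c q hq => ?_⟩
    have hF : IsFace P (minFace P π q (Ψ c)) :=
      isFace_minFace hP (mem_image_of_mem_cells hP c.2 hq)
    exact hF.normalCone_subset_normalCone_iff.1 (hle c q hq)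
  · rintro ⟨Φ, Ψ, hΦ, hBΦ, hΨ, hAΨ, hle⟩
    rw [← isCoherentOnCells_iff hP] at hΦ hΨ
    exact ⟨Ψ, Φ, hΨ, (hcones hA hΨ).2 hAΨ, hΦ, (hcones hB hΦ).2 hBΦ,
      fun c q hq => normalCone_anti (hle c q hq)⟩

theorem virtualCellLE_iff : VirtualCellLE P π A B ↔ (facePairing π hP).swap.FamilyLE B A := by
  rw [FacePairing.familyLE_iff (D := (facePairing π hP).swap) (cones_eq_image_cell hP)]
  constructor
  · rintro ⟨κ, μ, hκ, hA, hμ, hB, hle⟩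
    exact ⟨_, _, (isCoherentOnCones_iff hP).1 hμ, hB, (isCoherentOnCones_iff hP).1 hκ, hA, hle⟩
  · rintro ⟨Θ', Θ, hΘ', hB, hΘ, hA, hle⟩
    exact ⟨fun σ => ⟨Θ σ, hΘ.1 σ⟩, fun σ => ⟨Θ' σ, hΘ'.1 σ⟩, (isCoherentOnCones_iff hP).2 hΘ, hA,
      (isCoherentOnCones_iff hP).2 hΘ', hB, hle⟩

end Translation

section Unions

variable {V W : Type*} [NormedAddCommGroup V] [NormedSpace ℝ V]
  [NormedAddCommGroup W] [NormedSpace ℝ W] [FiniteDimensional ℝ V] [FiniteDimensional ℝ W]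
  {P F G : Set V} {π : V →L[ℝ] W} {q : W} {x : V} {l : V →L[ℝ] ℝ} {A B : Set (Set V)}
  (hP : IsPolytope P)
include hP

theorem mem_sUnion_family_iff {Ψ : W → KerDual π} (hΨ : (facePairing π hP).Coherent Ψ) :
    x ∈ ⋃₀ (facePairing π hP).family Ψ ↔ x ∈ P ∧ x ∈ minFace P π (π x) (Ψ (π x)) := by
  refine ⟨?_, fun ⟨hxP, hx⟩ => ⟨_, ⟨π x, mem_image_of_mem π hxP, rfl⟩, hx⟩⟩
  rintro ⟨_, ⟨q, hq, rfl⟩, hx⟩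
  have hF : IsFace P (minFace P π q (Ψ q)) := isFace_minFace hP hq
  have hxP : x ∈ P := hF.subset hx
  have hxQ : π x ∈ π '' P := mem_image_of_mem π hxP
  obtain ⟨ψ, hψq, hψx⟩ := hΨ.exists_mem_intrinsicInterior_dual hq (mem_image_of_mem π hx)
  have hface : minFace P π (π x) ψ = minFace P π (π x) (Ψ (π x)) :=
    FacePairing.face_eq (D := facePairing π hP) (isFace_minFace hP hxQ)
      (mem_intrinsicInterior_image_minFace hP hxQ) hψx
  obtain ⟨l, hl, rfl⟩ := (mem_intrinsicInterior_dualProj_image_iff hP hF).1 hψq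
  rw [← hface]
  exact ⟨hxP, fiberFace_subset_minFace (inter_fiber_subset_fiberFace hl.ge ⟨hx, rfl⟩)⟩

theorem unionLE_iff_familyLE (hA : A ∈ (facePairing π hP).coherentFamilies)
    (hB : B ∈ (facePairing π hP).coherentFamilies) :
    UnionLE A B ↔ (facePairing π hP).FamilyLE A B := by
  obtain ⟨Ψ, hΨ, rfl⟩ := hA
  obtain ⟨Φ, hΦ, rfl⟩ := hB
  rw [FacePairing.familyLE_family_iff hΨ hΦ]
  refine ⟨fun hle q hq => ?_, fun hle x hx => ?_⟩
  · obtain ⟨x, ⟨hxP, rfl, -⟩, hx⟩ :=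
      exists_mem_fiberFace_mem_intrinsicInterior_minFace hP (ψ := Ψ q) hq
    have hxΨ := (mem_sUnion_family_iff hP hΨ).2 ⟨hxP, intrinsicInterior_subset hx⟩
    exact (isFace_minFace hP hq).subset_of_mem_intrinsicInterior (isFace_minFace hP hq).subset hx
      ((mem_sUnion_family_iff hP hΦ).1 (hle hxΨ)).2
  · rw [mem_sUnion_family_iff hP hΨ] at hx
    exact (mem_sUnion_family_iff hP hΦ).2 ⟨hx.1, hle _ (mem_image_of_mem π hx.1) hx.2⟩

theorem mem_normalCone_of_dualProj_mem (hG : IsFace P G) (hqF : q ∈ π '' F)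
    (hqG : q ∈ intrinsicInterior ℝ (π '' G)) (hl : l ∈ normalCone P F)
    (hlG : dualProj π l ∈ dualProj π '' normalCone P G) : l ∈ normalCone P G := by
  obtain ⟨x, hx, rfl⟩ := hqF
  rw [hG.intrinsicInterior_image hP.convex] at hqG
  obtain ⟨y, hy, hyx⟩ := hqG
  obtain ⟨m, hm, hml⟩ := hlG
  have hy_fiber : y ∈ fiberFace P π (π x) (dualProj π m) :=
    inter_fiber_subset_fiberFace hm ⟨intrinsicInterior_subset hy, hyx⟩
  rw [hml, fiberFace_eq_toExposed] at hy_fiber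
  exact (hG.mem_normalCone_iff hy).2
    (mem_toExposed_of_le (hl hx) hy_fiber.1.1 (hy_fiber.2 x ⟨(hl hx).1, rfl⟩))

theorem mem_sUnion_conesOf_family_iff {μ : KerDual π → W}
    (hμ : (facePairing π hP).swap.Coherent μ) :
    l ∈ ⋃₀ conesOf P ((facePairing π hP).swap.family μ) ↔
      l ∈ normalCone P (minFace P π (μ (dualProj π l)) (dualProj π l)) := by
  refine ⟨?_, fun hl => ⟨_, ⟨_, ⟨dualProj π l, mem_univ _, rfl⟩, rfl⟩, hl⟩⟩
  rintro ⟨_, ⟨_, ⟨ψ, -, rfl⟩, rfl⟩, hl⟩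
  obtain ⟨q, hqψ, hql⟩ :=
    hμ.exists_mem_intrinsicInterior_dual (mem_univ ψ) (mem_image_of_mem (dualProj π) hl)
  have hμl : μ (dualProj π l) ∈ π '' P := hμ.1 (mem_univ _)
  exact mem_normalCone_of_dualProj_mem hP (isFace_minFace hP hμl)
    (intrinsicInterior_subset hqψ) hql hl (mem_dualProj_normalCone_minFace hP hμl)

theorem unionLE_conesOf_iff_familyLE (hA : A ∈ (facePairing π hP).swap.coherentFamilies)
    (hB : B ∈ (facePairing π hP).swap.coherentFamilies) :
    UnionLE (conesOf P A) (conesOf P B) ↔ (facePairing π hP).swap.FamilyLE A B := by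
  obtain ⟨μ, hμ, rfl⟩ := hA
  obtain ⟨ν, hν, rfl⟩ := hB
  rw [FacePairing.familyLE_family_iff hμ hν]
  refine ⟨fun hle ψ hψ => ?_, fun hle l hl => ?_⟩
  · have hq : μ ψ ∈ π '' P := hμ.1 hψ
    obtain ⟨l, hl, rfl⟩ :=
      (mem_intrinsicInterior_dualProj_image_iff hP (isFace_minFace hP hq)).1
        (mem_intrinsicInterior_dualProj_normalCone_minFace hP (ψ := ψ) hq)
    have hlν := (mem_sUnion_conesOf_family_iff hP hν).1
      (hle ((mem_sUnion_conesOf_family_iff hP hμ).2 hl.ge))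
    exact Subset.trans hlν hl.le
  · rw [mem_sUnion_conesOf_family_iff hP hμ] at hl
    exact (mem_sUnion_conesOf_family_iff hP hν).2 (normalCone_anti (hle _ (mem_univ _)) hl)

end Unions

section ConeSubdivisions

variable {E : Type*} [NormedAddCommGroup E] [NormedSpace ℝ E] {K : Set (Set E)} {X C D : Set E}
  {x : E}

theorem IsPolyhedralCone.convex (hC : IsPolyhedralCone C) : Convex ℝ C := by
  obtain ⟨M, -, rfl⟩ := hC
  exact (M : ConvexCone ℝ E).convex

theorem IsPolyhedralCone.zero_mem (hC : IsPolyhedralCone C) : (0 : E) ∈ C := by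
  obtain ⟨M, -, rfl⟩ := hC
  exact Submodule.zero_mem M

theorem IsPolyhedralCone.add_mem (hC : IsPolyhedralCone C) {y : E} (hx : x ∈ C) (hy : y ∈ C) :
    x + y ∈ C := by
  obtain ⟨M, -, rfl⟩ := hC
  exact Submodule.add_mem M hx hy

theorem IsFace.eq_of_mem_intrinsicInterior {F G : Set E} (hF : IsFace C F) (hG : IsFace C G)
    (hxF : x ∈ intrinsicInterior ℝ F) (hxG : x ∈ intrinsicInterior ℝ G) : F = G :=
  Subset.antisymm
    (hG.subset_of_mem_intrinsicInterior hF.subset hxF (intrinsicInterior_subset hxG))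
    (hF.subset_of_mem_intrinsicInterior hG.subset hxG (intrinsicInterior_subset hxF))

theorem IsConeSubdivision.isFace_of_mem_intrinsicInterior (hK : IsConeSubdivision K X)
    (hC : C ∈ K) (hD : D ∈ K) (hxC : x ∈ intrinsicInterior ℝ C) (hxD : x ∈ D) : IsFace D C := by
  obtain ⟨hC_face, hD_face⟩ := hK.inter_face C hC D hD
  have hCD : C ⊆ D := (hC_face.subset_of_mem_intrinsicInterior subset_rfl hxC
    ⟨intrinsicInterior_subset hxC, hxD⟩).trans inter_subset_right
  rwa [inter_eq_self_of_subset_left hCD] at hD_face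

theorem IsConeSubdivision.eq_of_mem_intrinsicInterior (hK : IsConeSubdivision K X)
    (hC : C ∈ K) (hD : D ∈ K) (hxC : x ∈ intrinsicInterior ℝ C)
    (hxD : x ∈ intrinsicInterior ℝ D) : C = D :=
  Subset.antisymm
    (hK.isFace_of_mem_intrinsicInterior hC hD hxC (intrinsicInterior_subset hxD)).subset
    (hK.isFace_of_mem_intrinsicInterior hD hC hxD (intrinsicInterior_subset hxC)).subset

variable [FiniteDimensional ℝ E]

theorem IsPolyhedralCone.exists_isFace_of_notMem_intrinsicInterior (hC : IsPolyhedralCone C)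
    (hx : x ∈ C) (hx_int : x ∉ intrinsicInterior ℝ C) :
    ∃ G, IsFace C G ∧ x ∈ G ∧ ¬ C ⊆ G := by
  obtain ⟨M, hM, rfl⟩ := hC
  obtain ⟨t, ht, htx, y, hy, hty⟩ :=
    exists_supporting_of_notMem_intrinsicInterior (topDualPairing ℝ E) hM hx hx_int
  simp only [topDualPairing_apply] at ht htx hty
  have hxt : x ∈ (-t).toExposed (M : Set E) := ⟨hx, fun z hz => by
    rw [neg_apply, neg_apply, htx]
    exact neg_le_neg (ht z hz)⟩
  refine ⟨_, isFace_toExposed hxt, hxt, fun hsub => hty.not_ge ?_⟩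
  have hle := (hsub hy).2 x hx
  rwa [neg_apply, neg_apply, neg_le_neg_iff, htx] at hle

theorem IsConeSubdivision.exists_mem_intrinsicInterior (hK : IsConeSubdivision K X)
    (hx : x ∈ X) : ∃ C ∈ K, x ∈ intrinsicInterior ℝ C := by
  obtain ⟨C₀, hC₀, hxC₀⟩ : x ∈ ⋃₀ K := hK.support ▸ hx
  obtain ⟨C, ⟨hC, hxC⟩, hmin⟩ :=
    (hK.finite.subset (sep_subset K fun C => x ∈ C)).exists_minimal ⟨C₀, hC₀, hxC₀⟩
  refine ⟨C, hC, ?_⟩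
  by_contra hx_int
  obtain ⟨G, hG, hxG, hCG⟩ :=
    (hK.polyhedral C hC).exists_isFace_of_notMem_intrinsicInterior hxC hx_int
  exact hCG (hmin ⟨hK.face_mem C hC G hG, hxG⟩ hG.subset)

theorem isConeSubdivision_range {B : E → Set E} (hfin : (range B).Finite)
    (hpoly : ∀ x, IsPolyhedralCone (B x)) (hint : ∀ x, x ∈ intrinsicInterior ℝ (B x))
    (hface : ∀ x, ∀ y ∈ B x, IsFace (B x) (B y)) : IsConeSubdivision (range B) univ where
  finite := hfin
  polyhedral := by
    rintro _ ⟨x, rfl⟩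
    exact hpoly x
  face_mem := by
    rintro _ ⟨x, rfl⟩ G hG
    obtain ⟨y, hy⟩ := hG.intrinsicInterior_nonempty (hpoly x).convex
    exact ⟨y, (hface x y (hG.subset (intrinsicInterior_subset hy))).eq_of_mem_intrinsicInterior
      hG (hint y) hy⟩
  inter_face := by
    rintro _ ⟨x, rfl⟩ _ ⟨z, rfl⟩
    obtain ⟨y, hy⟩ := Set.Nonempty.intrinsicInterior
      ((hpoly x).convex.inter (hpoly z).convex) ⟨0, (hpoly x).zero_mem, (hpoly z).zero_mem⟩
    obtain ⟨hyx, hyz⟩ := intrinsicInterior_subset hy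
    have hx := hface x y hyx
    have hz := hface z y hyz
    have heq : B x ∩ B z = B y := Subset.antisymm
      (hx.subset_of_mem_intrinsicInterior inter_subset_left hy (intrinsicInterior_subset (hint y)))
      (subset_inter hx.subset hz.subset)
    rw [heq]
    exact ⟨hx, hz⟩
  support := eq_univ_of_forall fun x => ⟨B x, mem_range_self x, intrinsicInterior_subset (hint x)⟩

theorem exists_eval_eq (t : (E →L[ℝ] ℝ) →L[ℝ] ℝ) : ∃ x : E, ∀ l, t l = l x := by
  obtain ⟨x, hx⟩ := (LinearMap.IsPerfPair.bijective_right (topDualPairing ℝ E)).2 t.toLinearMap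
  exact ⟨x, fun l => (LinearMap.congr_fun hx l).symm⟩

theorem IsPolyhedralCone.isFace_iff_exists_eval {C G : Set (E →L[ℝ] ℝ)}
    (hC : IsPolyhedralCone C) :
    IsFace C G ↔ ∃ x : E, (∀ l ∈ C, l x ≤ 0) ∧ ∀ l, l ∈ G ↔ l ∈ C ∧ l x = 0 := by
  constructor
  · rintro ⟨⟨m, hm⟩, t, rfl⟩
    obtain ⟨x, hx⟩ := exists_eval_eq t
    have hmax : ∀ l ∈ C, l x ≤ m x := fun l hl => by simpa only [hx] using hm.2 l hl
    have hmx : m x = 0 := by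
      have hmm := hmax _ (hC.add_mem hm.1 hm.1)
      have h0 := hmax _ hC.zero_mem
      rw [add_apply] at hmm
      rw [zero_apply] at h0
      linarith
    rw [hmx] at hmax
    refine ⟨x, hmax, fun l => and_congr_right fun hl => ?_⟩
    simp only [hx]
    exact ⟨fun h => le_antisymm (hmax l hl) (hmx ▸ h m hm.1), fun h l' hl' => h ▸ hmax l' hl'⟩
  · rintro ⟨x, hmax, hG⟩
    refine ⟨⟨0, (hG 0).2 ⟨hC.zero_mem, zero_apply x⟩⟩, ContinuousLinearMap.apply ℝ ℝ x, ?_⟩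
    ext l
    refine (hG l).trans (and_congr_right fun hl => ⟨fun h l' hl' => ?_, fun h => ?_⟩)
    · exact (hmax l' hl').trans_eq h.symm
    · exact le_antisymm (hmax l hl) (h 0 hC.zero_mem)

end ConeSubdivisions

section Costrings

variable {V W : Type*} [NormedAddCommGroup V] [NormedSpace ℝ V]
  [NormedAddCommGroup W] [NormedSpace ℝ W]
  {P F G : Set V} {π : V →L[ℝ] W} {q : W} {ψ φ : KerDual π}
  {C : Set (Set (V →L[ℝ] ℝ))}

theorem IsCostring.eq_of_mem_intrinsicInterior (hC : IsCostring π (normalFan P) C)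
    (hF : IsFace P F) (hFC : normalCone P F ∈ C) (hG : IsFace P G) (hGC : normalCone P G ∈ C)
    (hψF : ψ ∈ intrinsicInterior ℝ (dualProj π '' normalCone P F))
    (hψG : ψ ∈ intrinsicInterior ℝ (dualProj π '' normalCone P G)) : F = G :=
  injOn_normalCone hF hG <| hC.noRepetition hFC hGC <| hC.subdivision.eq_of_mem_intrinsicInterior
    (mem_image_of_mem _ hFC) (mem_image_of_mem _ hGC) hψF hψG

variable [FiniteDimensional ℝ V] (hP : IsPolytope P)
include hP

theorem dualProj_image_sUnion_normalFan : dualProj π '' ⋃₀ normalFan P = univ := by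
  refine eq_univ_of_forall fun ψ => ?_
  obtain ⟨q, hq⟩ := hP.nonempty.image π
  obtain ⟨l, hl, hlψ⟩ := mem_dualProj_normalCone_minFace hP (ψ := ψ) hq
  exact ⟨l, ⟨_, mem_image_of_mem _ (isFace_minFace hP hq), hl⟩, hlψ⟩

theorem IsCostring.exists_mem_intrinsicInterior (hC : IsCostring π (normalFan P) C)
    (ψ : KerDual π) :
    ∃ F, IsFace P F ∧ normalCone P F ∈ C ∧
      ψ ∈ intrinsicInterior ℝ (dualProj π '' normalCone P F) := by
  obtain ⟨_, ⟨s, hs, rfl⟩, hψ⟩ := IsConeSubdivision.exists_mem_intrinsicInterior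
    (E := KerDual π) hC.subdivision
    ((dualProj_image_sUnion_normalFan hP).ge (mem_univ ψ))
  obtain ⟨F, hF, rfl⟩ := hC.subset hs
  exact ⟨F, hF, hs, hψ⟩

variable [FiniteDimensional ℝ W]

theorem isFace_dualProj_image (hF : IsFace P F) (hG : IsFace P G) (hFG : F ⊆ G)
    (hqF : q ∈ intrinsicInterior ℝ (π '' F)) (hqG : q ∈ intrinsicInterior ℝ (π '' G)) :
    IsFace (dualProj π '' normalCone P F) (dualProj π '' normalCone P G) := by
  rw [hF.intrinsicInterior_image hP.convex] at hqF
  rw [hG.intrinsicInterior_image hP.convex] at hqG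
  obtain ⟨x, hx, rfl⟩ := hqF
  obtain ⟨y, hy, hyx⟩ := hqG
  have hxF := intrinsicInterior_subset hx
  have hyG := intrinsicInterior_subset hy
  have hk : y - x ∈ LinearMap.ker π.toLinearMap := LinearMap.sub_mem_ker_iff.2 hyx
  have hval : ∀ l : V →L[ℝ] ℝ, dualProj π l ⟨y - x, hk⟩ = l y - l x := fun l => by
    rw [dualProj_apply, map_sub]
  refine (isPolyhedralCone_dualProj_image hP π hF).isFace_iff_exists_eval.2
    ⟨⟨y - x, hk⟩, ?_, fun χ => ⟨?_, ?_⟩⟩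
  · rintro _ ⟨l, hl, rfl⟩
    rw [hval, sub_nonpos]
    exact (hl hxF).2 y (hG.subset hyG)
  · rintro ⟨m, hm, rfl⟩
    refine ⟨⟨m, normalCone_anti hFG hm, rfl⟩, ?_⟩
    rw [hval, sub_eq_zero]
    exact le_antisymm ((hm (hFG hxF)).2 y (hG.subset hyG)) ((hm hyG).2 x (hF.subset hxF))
  · rintro ⟨⟨l, hl, rfl⟩, hl_zero⟩
    rw [hval, sub_eq_zero] at hl_zero
    exact ⟨l, (hG.mem_normalCone_iff hy).2
      (mem_toExposed_of_le (hl hxF) (hG.subset hyG) hl_zero.ge), rfl⟩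

section Coherent

variable {μ : KerDual π → W} (hμ : (facePairing π hP).swap.Coherent μ)
include hμ

theorem isFace_minFace_of_coherent (ψ : KerDual π) : IsFace P (minFace P π (μ ψ) ψ) :=
  isFace_minFace hP (hμ.1 (mem_univ ψ))

theorem mem_intrinsicInterior_dualProj_of_coherent (ψ : KerDual π) :
    ψ ∈ intrinsicInterior ℝ (dualProj π '' normalCone P (minFace P π (μ ψ) ψ)) :=
  mem_intrinsicInterior_dualProj_normalCone_minFace hP (hμ.1 (mem_univ ψ))

theorem isFace_dualProj_image_of_coherent
    (hφ : φ ∈ dualProj π '' normalCone P (minFace P π (μ ψ) ψ)) :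
    IsFace (dualProj π '' normalCone P (minFace P π (μ ψ) ψ))
      (dualProj π '' normalCone P (minFace P π (μ φ) φ)) := by
  obtain ⟨q, hqψ, hqφ⟩ := hμ.exists_mem_intrinsicInterior_dual (mem_univ ψ) hφ
  exact isFace_dualProj_image hP (isFace_minFace_of_coherent hP hμ ψ)
    (isFace_minFace_of_coherent hP hμ φ) (hμ.le (mem_univ ψ) hφ) hqψ hqφ

theorem isConeSubdivision_of_coherent :
    IsConeSubdivision
      ((fun s => dualProj π '' s) '' conesOf P ((facePairing π hP).swap.family μ)) univ := by
  have hrange : (fun s => dualProj π '' s) '' conesOf P ((facePairing π hP).swap.family μ) =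
      range fun ψ => dualProj π '' normalCone P (minFace P π (μ ψ) ψ) := by
    ext s
    constructor
    · rintro ⟨_, ⟨_, ⟨ψ, -, rfl⟩, rfl⟩, rfl⟩
      exact ⟨ψ, rfl⟩
    · rintro ⟨ψ, rfl⟩
      exact ⟨_, ⟨_, ⟨ψ, mem_univ _, rfl⟩, rfl⟩, rfl⟩
  have hfinite := (((finite_faces hP).subset (FacePairing.Coherent.family_subset hμ)).image
    (normalCone P)).image fun s => dualProj π '' s
  rw [hrange]
  exact isConeSubdivision_range (E := KerDual π) (hrange ▸ hfinite)
    (fun ψ => isPolyhedralCone_dualProj_image hP π (isFace_minFace_of_coherent hP hμ ψ))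
    (mem_intrinsicInterior_dualProj_of_coherent hP hμ)
    fun _ _ => isFace_dualProj_image_of_coherent hP hμ

theorem injOn_dualProj_image_of_coherent :
    InjOn (fun s => dualProj π '' s) (conesOf P ((facePairing π hP).swap.family μ)) := by
  rintro _ ⟨F, hF, rfl⟩ _ ⟨G, hG, rfl⟩ (heq : dualProj π '' _ = dualProj π '' _)
  obtain ⟨ψ, hψ⟩ := FacePairing.intrinsicInterior_dual_nonempty (D := facePairing π hP)
    (FacePairing.Coherent.family_subset hμ hF)
  have hψG : ψ ∈ intrinsicInterior ℝ (dualProj π '' normalCone P G) := heq ▸ hψ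
  rw [hμ.eq_face hF hψ, hμ.eq_face hG hψG]

theorem normalCone_eq_preimage_inter_of_coherent
    (hφ : φ ∈ dualProj π '' normalCone P (minFace P π (μ ψ) ψ)) :
    normalCone P (minFace P π (μ φ) φ) =
      dualProj π ⁻¹' (dualProj π '' normalCone P (minFace P π (μ φ) φ)) ∩
        normalCone P (minFace P π (μ ψ) ψ) := by
  obtain ⟨q, hqψ, hqφ⟩ := hμ.exists_mem_intrinsicInterior_dual (mem_univ ψ) hφ
  refine Subset.antisymm (subset_inter (subset_preimage_image _ _)
    (normalCone_anti (hμ.le (mem_univ ψ) hφ))) fun l ⟨hlφ, hlψ⟩ => ?_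
  exact mem_normalCone_of_dualProj_mem hP (isFace_minFace_of_coherent hP hμ φ)
    (intrinsicInterior_subset hqψ) hqφ hlψ hlφ

theorem isCostring_of_coherent :
    IsCostring π (normalFan P) (conesOf P ((facePairing π hP).swap.family μ)) where
  subset := image_mono (FacePairing.Coherent.family_subset hμ)
  subdivision := by
    rw [dualProj_image_sUnion_normalFan hP]
    exact isConeSubdivision_of_coherent hP hμ
  noRepetition := injOn_dualProj_image_of_coherent hP hμ
  lift := by
    rintro _ ⟨_, ⟨φ, -, rfl⟩, rfl⟩ _ ⟨_, ⟨ψ, -, rfl⟩, rfl⟩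
    refine ⟨fun hsub => ?_, fun heq => image_mono (heq.trans_subset inter_subset_right)⟩
    exact normalCone_eq_preimage_inter_of_coherent hP hμ
      (hsub (intrinsicInterior_subset (mem_intrinsicInterior_dualProj_of_coherent hP hμ φ)))

end Coherent

-- A point of `relint F` moved a little in the direction `k` lies in `relint G`.
theorem intrinsicInterior_image_subset_of_mem_normalCone_iff (hF : IsFace P F) (hG : IsFace P G)
    {k : LinearMap.ker π.toLinearMap} (hk : ∀ l ∈ normalCone P F, l k ≤ 0)
    (hFG : ∀ l, l ∈ normalCone P G ↔ l ∈ normalCone P F ∧ l k = 0) :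
    intrinsicInterior ℝ (π '' F) ⊆ intrinsicInterior ℝ (π '' G) := by
  rw [hF.intrinsicInterior_image hP.convex, hG.intrinsicInterior_image hP.convex]
  rintro _ ⟨x, hx, rfl⟩
  have hxF := intrinsicInterior_subset hx
  have hxP := hF.subset hxF
  obtain ⟨ε, hε, hε_mem⟩ := hF.exists_add_smul_mem hP hx hk
  have hyP : x + (ε / 2) • (k : V) ∈ P := by
    have hmem := hP.convex.add_smul_mem hxP hε_mem (t := 1 / 2) (by norm_num)
    rwa [smul_smul, one_div_mul_eq_div] at hmem
  refine ⟨x + (ε / 2) • (k : V), (hG.mem_intrinsicInterior_iff hP).2 ⟨?_, ?_⟩,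
    map_add_ker ((ε / 2) • k)⟩
  · obtain ⟨n, hn⟩ := hG.isExposed hG.1
    obtain ⟨hnF, hnk⟩ := (hFG n).1 hn.le
    refine hn.ge (mem_toExposed_of_le (hnF hxF) hyP ?_)
    rw [map_add, map_smul, hnk, smul_zero, add_zero]
  · rintro _ ⟨_, m, rfl⟩ hmy
    have hmx_le := hmy.2 x hxP
    have hmε_le := hmy.2 _ hε_mem
    simp only [map_add, map_smul, smul_eq_mul] at hmx_le hmε_le
    have hmk : m k = 0 := by nlinarith
    have hmx : x ∈ m.toExposed P := mem_toExposed_of_le hmy hxP (by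
      rw [map_add, map_smul, hmk, smul_zero, add_zero])
    exact (hFG m).2 ⟨(hF.mem_normalCone_iff hx).2 hmx, hmk⟩

theorem intrinsicInterior_image_subset_of_isFace_dualProj_image (hF : IsFace P F)
    (hG : IsFace P G)
    (hface : IsFace (dualProj π '' normalCone P F) (dualProj π '' normalCone P G))
    (hlift : normalCone P G = dualProj π ⁻¹' (dualProj π '' normalCone P G) ∩ normalCone P F) :
    intrinsicInterior ℝ (π '' F) ⊆ intrinsicInterior ℝ (π '' G) := by
  obtain ⟨k, hk, hk_face⟩ :=
    (isPolyhedralCone_dualProj_image hP π hF).isFace_iff_exists_eval.1 hface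
  refine intrinsicInterior_image_subset_of_mem_normalCone_iff hP hF hG (k := k)
    (fun l hl => hk _ (mem_image_of_mem _ hl)) fun l => ⟨fun hl => ?_, fun ⟨hl, hlk⟩ => ?_⟩
  · exact ⟨(hlift.le hl).2, ((hk_face _).1 (mem_image_of_mem _ hl)).2⟩
  · exact hlift.ge ⟨(hk_face _).2 ⟨mem_image_of_mem _ hl, hlk⟩, hl⟩

theorem IsCostring.intrinsicInterior_image_subset (hC : IsCostring π (normalFan P) C)
    (hF : IsFace P F) (hFC : normalCone P F ∈ C) (hG : IsFace P G) (hGC : normalCone P G ∈ C)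
    (hψG : ψ ∈ intrinsicInterior ℝ (dualProj π '' normalCone P G))
    (hψF : ψ ∈ dualProj π '' normalCone P F) :
    intrinsicInterior ℝ (π '' F) ⊆ intrinsicInterior ℝ (π '' G) := by
  have hface := hC.subdivision.isFace_of_mem_intrinsicInterior
    (mem_image_of_mem _ hGC) (mem_image_of_mem _ hFC) hψG hψF
  exact intrinsicInterior_image_subset_of_isFace_dualProj_image hP hF hG hface
    ((hC.lift _ hGC _ hFC).1 hface.subset)

theorem IsCostring.exists_coherent (hC : IsCostring π (normalFan P) C) :
    ∃ μ, (facePairing π hP).swap.Coherent μ ∧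
      C = conesOf P ((facePairing π hP).swap.family μ) := by
  choose F hF hFC hFψ using hC.exists_mem_intrinsicInterior hP
  obtain ⟨μ, hμ, hface⟩ := FacePairing.exists_coherent_face_eq (D := (facePairing π hP).swap)
    (fun ψ _ => hF ψ) (fun ψ _ => hFψ ψ) fun ψ _ φ hφ =>
      hC.intrinsicInterior_image_subset hP (hF ψ) (hFC ψ) (hF φ) (hFC φ) (hFψ φ) hφ
  refine ⟨μ, hμ, Subset.antisymm (fun s hs => ?_) ?_⟩
  · obtain ⟨G, hG, rfl⟩ := hC.subset hs
    obtain ⟨ψ, hψ⟩ := FacePairing.intrinsicInterior_dual_nonempty (D := facePairing π hP) hG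
    refine ⟨G, ⟨ψ, mem_univ ψ, ?_⟩, rfl⟩
    rw [hface ψ (mem_univ ψ)]
    exact hC.eq_of_mem_intrinsicInterior hG hs (hF ψ) (hFC ψ) hψ (hFψ ψ)
  · rintro _ ⟨_, ⟨ψ, -, rfl⟩, rfl⟩
    rw [hface ψ (mem_univ ψ)]
    exact hFC ψ

theorem costrings_eq_image : costrings P π = conesOf P '' virtualCells P π := by
  rw [virtualCells_eq_coherentFamilies hP]
  ext C
  constructor
  · intro hC
    obtain ⟨μ, hμ, rfl⟩ := hC.exists_coherent hP
    exact ⟨_, ⟨μ, hμ, rfl⟩, rfl⟩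
  · rintro ⟨_, ⟨μ, hμ, rfl⟩, rfl⟩
    exact isCostring_of_coherent hP hμ

end Costrings

section OrderLemmas

variable {α β γ : Type*} {A : Set α} {B : Set β} {C : Set γ} {r : α → α → Prop}
  {s s' : β → β → Prop} {t : γ → γ → Prop} {f f' : α → β} {g : β → γ} {f₁ : β → α}

theorem IsAntiIsoOn.isPartialOrderOn (h : IsAntiIsoOn f A r B s) (hr : IsPartialOrderOn A r) :
    IsPartialOrderOn B s := by
  rw [← h.bijOn.image_eq]
  refine ⟨?_, ?_, ?_⟩
  · rintro _ ⟨a, ha, rfl⟩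
    exact (h.rev a ha a ha).1 (hr.refl a ha)
  · rintro _ ⟨a, ha, rfl⟩ _ ⟨b, hb, rfl⟩ _ ⟨c, hc, rfl⟩ hab hbc
    exact (h.rev c hc a ha).1
      (hr.trans c hc b hb a ha ((h.rev c hc b hb).2 hbc) ((h.rev b hb a ha).2 hab))
  · rintro _ ⟨a, ha, rfl⟩ _ ⟨b, hb, rfl⟩ hab hba
    rw [hr.antisymm a ha b hb ((h.rev a ha b hb).2 hba) ((h.rev b hb a ha).2 hab)]

theorem IsAntiIsoOn.symm (h : IsAntiIsoOn f A r B s) (hf₁ : LeftInvOn f₁ f A) :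
    IsAntiIsoOn f₁ B s A r := by
  have hinv : InvOn f₁ f A B := ⟨hf₁, h.bijOn.image_eq ▸ hf₁.rightInvOn_image⟩
  have hbij := (bijOn_comm hinv).2 h.bijOn
  refine ⟨hbij, fun b hb b' hb' => ?_⟩
  rw [h.rev _ (hbij.mapsTo hb') _ (hbij.mapsTo hb), hinv.2 hb, hinv.2 hb']

theorem IsAntiIsoOn.dual (h : IsAntiIsoOn f A r B s) :
    IsAntiIsoOn f A (flip r) B (flip s) :=
  ⟨h.bijOn, fun a ha a' ha' => h.rev a' ha' a ha⟩

theorem IsEmbeddingOn.isAntiIsoOn_image (h : IsEmbeddingOn f A r B (flip s)) :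
    IsAntiIsoOn f A r (f '' A) s :=
  ⟨h.injOn.bijOn_image, h.iff⟩

theorem IsAntiIsoOn.comp_isEmbeddingOn (hg : IsAntiIsoOn g B s C t)
    (hf : IsEmbeddingOn f A r B s) : IsEmbeddingOn (g ∘ f) A r C (flip t) :=
  ⟨hg.bijOn.mapsTo.comp hf.mapsTo, hg.bijOn.injOn.comp hf.injOn hf.mapsTo, fun a ha a' ha' =>
    (hf.iff a ha a' ha').trans (hg.rev _ (hf.mapsTo ha) _ (hf.mapsTo ha'))⟩

theorem IsEmbeddingOn.congr (h : IsEmbeddingOn f A r B s) (hf : EqOn f f' A)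
    (hs : ∀ b ∈ B, ∀ b' ∈ B, (s b b' ↔ s' b b')) : IsEmbeddingOn f' A r B s' := by
  refine ⟨h.mapsTo.congr hf, h.injOn.congr hf, fun a ha a' ha' => ?_⟩
  rw [h.iff a ha a' ha', hs _ (h.mapsTo ha) _ (h.mapsTo ha'), hf ha, hf ha']

end OrderLemmas

section Correspondence

variable {V : Type*} [NormedAddCommGroup V] [NormedSpace ℝ V] {P : Set V}
  {A : Set (Set V)} {C : Set (Set (V →L[ℝ] ℝ))} {S : Set (Set (Set V))}
  {r : Set (Set V) → Set (Set V) → Prop}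
  {s : Set (Set (V →L[ℝ] ℝ)) → Set (Set (V →L[ℝ] ℝ)) → Prop}

theorem facesOf_conesOf (hA : A ⊆ faces P) : facesOf P (conesOf P A) = A := by
  ext F
  exact ⟨fun hF => (injOn_normalCone.mem_image_iff hA hF.1).1 hF.2,
    fun hF => ⟨hA hF, mem_image_of_mem _ hF⟩⟩

theorem conesOf_facesOf (hC : C ⊆ normalFan P) : conesOf P (facesOf P C) = C := by
  refine Subset.antisymm (image_subset_iff.2 fun F hF => hF.2) fun N hN => ?_
  obtain ⟨F, hF, rfl⟩ := hC hN
  exact ⟨F, ⟨hF, hN⟩, rfl⟩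

theorem conesOf_mem_image_iff (hS : ∀ A ∈ S, A ⊆ faces P) (hA : A ⊆ faces P) :
    conesOf P A ∈ conesOf P '' S ↔ A ∈ S :=
  injOn_conesOf.mem_image_iff hS hA

theorem isAntiIsoOn_conesOf (hS : ∀ A ∈ S, A ⊆ faces P)
    (h : ∀ A ∈ S, ∀ B ∈ S, (r A B ↔ s (conesOf P B) (conesOf P A))) :
    IsAntiIsoOn (conesOf P) S r (conesOf P '' S) s :=
  ⟨(injOn_conesOf.mono hS).bijOn_image, h⟩

end Correspondence

section Posets

variable {V W : Type*} [NormedAddCommGroup V] [NormedSpace ℝ V] [FiniteDimensional ℝ V]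
  [NormedAddCommGroup W] [NormedSpace ℝ W] [FiniteDimensional ℝ W]
  {P : Set V} {π : V →L[ℝ] W} {A : Set (Set V)} {C : Set (Set (V →L[ℝ] ℝ))} (hP : IsPolytope P)
include hP

theorem mem_strings_iff (hA : A ⊆ faces P) :
    A ∈ strings P π ↔ conesOf P A ∈ virtualCones P π := by
  rw [virtualCones_eq_image, conesOf_mem_image_iff (fun _ => subset_faces_of_mem_strings hP) hA]

theorem mem_virtualCells_iff (hA : A ⊆ faces P) :
    A ∈ virtualCells P π ↔ conesOf P A ∈ costrings P π := by
  rw [costrings_eq_image hP,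
    conesOf_mem_image_iff (fun _ => subset_faces_of_mem_virtualCells hP) hA]

theorem mem_costrings_iff (hC : C ⊆ normalFan P) :
    C ∈ costrings P π ↔ facesOf P C ∈ virtualCells P π := by
  rw [mem_virtualCells_iff hP fun F hF => hF.1, conesOf_facesOf hC]

theorem mem_virtualCones_iff (hC : C ⊆ normalFan P) :
    C ∈ virtualCones P π ↔ facesOf P C ∈ strings P π := by
  rw [mem_strings_iff hP fun F hF => hF.1, conesOf_facesOf hC]

theorem subset_normalFan_of_mem_virtualCones (hC : C ∈ virtualCones P π) : C ⊆ normalFan P := by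
  rw [virtualCones_eq_image] at hC
  obtain ⟨A, hA, rfl⟩ := hC
  exact image_mono (subset_faces_of_mem_strings hP hA)

theorem isPartialOrderOn_strings : IsPartialOrderOn (strings P π) UnionLE := by
  rw [strings_eq_coherentFamilies hP]
  exact ⟨fun A _ => Subset.rfl, fun A _ B _ C _ => Subset.trans, fun A hA B hB hAB hBA =>
    ((unionLE_iff_familyLE hP hA hB).1 hAB).antisymm ((unionLE_iff_familyLE hP hB hA).1 hBA)⟩

theorem isAntiIsoOn_conesOf_strings :
    IsAntiIsoOn (conesOf P) (strings P π) UnionLE (virtualCones P π) (VirtualConeLE P π) := by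
  rw [virtualCones_eq_image]
  refine isAntiIsoOn_conesOf (fun A => subset_faces_of_mem_strings hP) fun A hA B hB => ?_
  rw [virtualConeLE_conesOf_iff hP hB hA]
  rw [strings_eq_coherentFamilies hP] at hA hB
  exact unionLE_iff_familyLE hP hA hB

theorem isAntiIsoOn_conesOf_virtualCells :
    IsAntiIsoOn (conesOf P) (virtualCells P π) (VirtualCellLE P π) (costrings P π) UnionLE := by
  rw [costrings_eq_image hP]
  refine isAntiIsoOn_conesOf (fun A => subset_faces_of_mem_virtualCells hP) fun A hA B hB => ?_
  rw [virtualCells_eq_coherentFamilies hP] at hA hB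
  exact (virtualCellLE_iff hP).trans (unionLE_conesOf_iff_familyLE hP hB hA).symm

theorem isAntiIsoOn_facesOf_virtualCones :
    IsAntiIsoOn (facesOf P) (virtualCones P π) (VirtualConeLE P π) (strings P π) UnionLE :=
  (isAntiIsoOn_conesOf_strings hP).symm fun _ hA =>
    facesOf_conesOf (subset_faces_of_mem_strings hP hA)

theorem isAntiIsoOn_facesOf_costrings :
    IsAntiIsoOn (facesOf P) (costrings P π) UnionLE (virtualCells P π) (VirtualCellLE P π) :=
  (isAntiIsoOn_conesOf_virtualCells hP).symm fun _ hA =>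
    facesOf_conesOf (subset_faces_of_mem_virtualCells hP hA)

theorem isPartialOrderOn_virtualCones :
    IsPartialOrderOn (virtualCones P π) (VirtualConeLE P π) :=
  (isAntiIsoOn_conesOf_strings hP).isPartialOrderOn (isPartialOrderOn_strings hP)

theorem isPartialOrderOn_costrings : IsPartialOrderOn (costrings P π) UnionLE := by
  refine ⟨fun C _ => Subset.rfl, fun C _ D _ E _ => Subset.trans, ?_⟩
  rw [costrings_eq_image hP, virtualCells_eq_coherentFamilies hP]
  rintro _ ⟨A, hA, rfl⟩ _ ⟨B, hB, rfl⟩ hAB hBA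
  rw [((unionLE_conesOf_iff_familyLE hP hA hB).1 hAB).antisymm
    ((unionLE_conesOf_iff_familyLE hP hB hA).1 hBA)]

theorem isPartialOrderOn_virtualCells :
    IsPartialOrderOn (virtualCells P π) (VirtualCellLE P π) :=
  (isAntiIsoOn_facesOf_costrings hP).isPartialOrderOn (isPartialOrderOn_costrings hP)

end Posets

section CoherentStrings

variable {V W : Type*} [NormedAddCommGroup V] [NormedSpace ℝ V]
  [NormedAddCommGroup W] [NormedSpace ℝ W] {P : Set V} {π : V →L[ℝ] W}

theorem conesOf_stringOfCone (σ : Set (KerDual π)) :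
    conesOf P (stringOfCone P π σ) = virtualConeOfCone P π σ := by
  simp only [virtualConeOfCone, ← conesOf_stringOf, conesOf, stringOfCone, coherentString,
    image_iUnion₂]

variable [FiniteDimensional ℝ V] [FiniteDimensional ℝ W] (hP : IsPolytope P)
include hP

theorem stringOfCone_eq_familyOfDualCell :
    stringOfCone P π = (facePairing π hP).familyOfDualCell := by
  funext σ
  simp only [stringOfCone, coherentString_eq_family hP, FacePairing.familyOfDualCell]

theorem isEmbeddingOn_stringOfCone :
    IsEmbeddingOn (stringOfCone P π) (cones P π) (· ⊆ ·) (strings P π) (flip UnionLE) := by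
  rw [stringOfCone_eq_familyOfDualCell hP, cones_eq_image_cell hP,
    strings_eq_coherentFamilies hP]
  exact (facePairing π hP).isEmbeddingOn_familyOfDualCell.congr (eqOn_refl _ _)
    fun A hA B hB => (unionLE_iff_familyLE hP hB hA).symm

theorem coherentStrings_eq_image : coherentStrings P π = stringOfCone P π '' cones P π := by
  rw [cones, ← range_comp, stringOfCone_eq_familyOfDualCell hP]
  refine congr_arg range (funext fun ψ => ?_)
  rw [coherentString_eq_family hP]
  exact (FacePairing.familyOfDualCell_cell (D := facePairing π hP) (mem_univ ψ)).symm

theorem coherentStrings_subset_strings : coherentStrings P π ⊆ strings P π := by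
  rw [coherentStrings_eq_image hP]
  exact (isEmbeddingOn_stringOfCone hP).mapsTo.image_subset

theorem isAntiIsoOn_stringOfCone :
    IsAntiIsoOn (stringOfCone P π) (cones P π) (· ⊆ ·) (coherentStrings P π) UnionLE := by
  rw [coherentStrings_eq_image hP]
  exact (isEmbeddingOn_stringOfCone hP).isAntiIsoOn_image

theorem isEmbeddingOn_virtualConeOfCone :
    IsEmbeddingOn (virtualConeOfCone P π) (cones P π) (· ⊆ ·) (virtualCones P π)
      (VirtualConeLE P π) :=
  ((isAntiIsoOn_conesOf_strings hP).dual.comp_isEmbeddingOn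
    (isEmbeddingOn_stringOfCone hP)).congr (fun σ _ => conesOf_stringOfCone σ)
    fun _ _ _ _ => Iff.rfl

end CoherentStrings

section CoherentCostrings

variable {V W : Type*} [NormedAddCommGroup V] [NormedSpace ℝ V] [FiniteDimensional ℝ V]
  [NormedAddCommGroup W] [NormedSpace ℝ W] [FiniteDimensional ℝ W]
  {P : Set V} {π : V →L[ℝ] W} {c : Set W} (hP : IsPolytope P)
include hP

theorem virtualCellOf_const {q : W} (hq : q ∈ π '' P) :
    virtualCellOf P π (fun _ => ⟨q, hq⟩) = (facePairing π hP).swap.family fun _ => q :=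
  FacePairing.cellFamily_const (D := (facePairing π hP).swap) (cones_eq_image_cell hP) q

theorem virtualCellOfCell_eq_familyOfDualCell (hc : c ∈ cells P π) :
    virtualCellOfCell P π c = (facePairing π hP).swap.familyOfDualCell c := by
  ext F
  simp only [FacePairing.familyOfDualCell, mem_iUnion₂, exists_prop]
  refine exists_congr fun q => and_congr_right fun hq => ?_
  simp only [virtualCellOf_const hP, exists_prop, mem_image_of_mem_cells hP hc hq, true_and]

theorem isEmbeddingOn_virtualCellOfCell :
    IsEmbeddingOn (virtualCellOfCell P π) (cells P π) (· ⊆ ·) (virtualCells P π)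
      (VirtualCellLE P π) := by
  rw [virtualCells_eq_coherentFamilies hP]
  exact (facePairing π hP).swap.isEmbeddingOn_familyOfDualCell.congr
    (fun c hc => (virtualCellOfCell_eq_familyOfDualCell hP hc).symm)
    fun A _ B _ => (virtualCellLE_iff hP).symm

theorem coherentCostring_eq_conesOf (q : W) :
    coherentCostring P π q = conesOf P ((facePairing π hP).swap.family fun _ => q) := by
  refine (range_comp (normalCone P) (minFace P π q)).trans (congr_arg (image _) ?_)
  ext F
  exact ⟨fun ⟨ψ, hψ⟩ => ⟨ψ, mem_univ ψ, hψ.symm⟩, fun ⟨ψ, _, hψ⟩ => ⟨ψ, hψ.symm⟩⟩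

theorem conesOf_virtualCellOfCell (hc : c ∈ cells P π) :
    conesOf P (virtualCellOfCell P π c) = costringOfCell P π c := by
  simp only [virtualCellOfCell_eq_familyOfDualCell hP hc, FacePairing.familyOfDualCell,
    costringOfCell, coherentCostring_eq_conesOf hP, conesOf, image_iUnion₂]

theorem isEmbeddingOn_costringOfCell :
    IsEmbeddingOn (costringOfCell P π) (cells P π) (· ⊆ ·) (costrings P π) (flip UnionLE) :=
  ((isAntiIsoOn_conesOf_virtualCells hP).comp_isEmbeddingOn
    (isEmbeddingOn_virtualCellOfCell hP)).congr (fun _ hc => conesOf_virtualCellOfCell hP hc)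
    fun _ _ _ _ => Iff.rfl

theorem coherentCostrings_eq_image :
    coherentCostrings P π = costringOfCell P π '' cells P π := by
  rw [cells, image_image]
  refine image_congr fun q hq => ?_
  rw [← conesOf_virtualCellOfCell hP (mem_image_of_mem _ hq),
    virtualCellOfCell_eq_familyOfDualCell hP (mem_image_of_mem _ hq),
    coherentCostring_eq_conesOf hP]
  exact congr_arg _
    (FacePairing.familyOfDualCell_cell (D := (facePairing π hP).swap) hq).symm

theorem coherentCostrings_subset_costrings : coherentCostrings P π ⊆ costrings P π := by
  rw [coherentCostrings_eq_image hP]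
  exact (isEmbeddingOn_costringOfCell hP).mapsTo.image_subset

theorem isAntiIsoOn_costringOfCell :
    IsAntiIsoOn (costringOfCell P π) (cells P π) (· ⊆ ·) (coherentCostrings P π) UnionLE := by
  rw [coherentCostrings_eq_image hP]
  exact (isEmbeddingOn_costringOfCell hP).isAntiIsoOn_image

end CoherentCostrings

end FanDuality

open FanDuality in
theorem theoremA_general {V W : Type*} [NormedAddCommGroup V] [NormedSpace ℝ V]
    [FiniteDimensional ℝ V] [NormedAddCommGroup W] [NormedSpace ℝ W] [FiniteDimensional ℝ W]
    (π : V →L[ℝ] W) (P : Set V) (hP : IsPolytope P) :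
    (∀ A ⊆ faces P, (A ∈ strings P π ↔ conesOf P A ∈ virtualCones P π)) ∧
    (∀ A ⊆ faces P, (A ∈ virtualCells P π ↔ conesOf P A ∈ costrings P π)) ∧
    (∀ C ⊆ normalFan P, (C ∈ costrings P π ↔ facesOf P C ∈ virtualCells P π)) ∧
    (∀ C ⊆ normalFan P, (C ∈ virtualCones P π ↔ facesOf P C ∈ strings P π)) ∧
    (∀ A ∈ strings P π, A ⊆ faces P) ∧ (∀ A ∈ virtualCells P π, A ⊆ faces P) ∧
    (∀ C ∈ virtualCones P π, C ⊆ normalFan P) ∧ (∀ C ∈ costrings P π, C ⊆ normalFan P) ∧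
    IsPartialOrderOn (strings P π) UnionLE ∧
    IsPartialOrderOn (virtualCones P π) (VirtualConeLE P π) ∧
    IsPartialOrderOn (costrings P π) UnionLE ∧
    IsPartialOrderOn (virtualCells P π) (VirtualCellLE P π) ∧
    IsAntiIsoOn (conesOf P) (strings P π) UnionLE (virtualCones P π) (VirtualConeLE P π) ∧
    IsAntiIsoOn (facesOf P) (virtualCones P π) (VirtualConeLE P π) (strings P π) UnionLE ∧
    IsAntiIsoOn (conesOf P) (virtualCells P π) (VirtualCellLE P π) (costrings P π) UnionLE ∧
    IsAntiIsoOn (facesOf P) (costrings P π) UnionLE (virtualCells P π) (VirtualCellLE P π) ∧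
    coherentStrings P π ⊆ strings P π ∧
    IsAntiIsoOn (stringOfCone P π) (cones P π) (· ⊆ ·) (coherentStrings P π) UnionLE ∧
    IsEmbeddingOn (virtualConeOfCone P π) (cones P π) (· ⊆ ·)
      (virtualCones P π) (VirtualConeLE P π) ∧
    (∀ σ ∈ cones P π, conesOf P (stringOfCone P π σ) = virtualConeOfCone P π σ) ∧
    coherentCostrings P π ⊆ costrings P π ∧
    IsAntiIsoOn (costringOfCell P π) (cells P π) (· ⊆ ·) (coherentCostrings P π) UnionLE ∧
    IsEmbeddingOn (virtualCellOfCell P π) (cells P π) (· ⊆ ·)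
      (virtualCells P π) (VirtualCellLE P π) ∧
    (∀ c ∈ cells P π, conesOf P (virtualCellOfCell P π c) = costringOfCell P π c) :=
  ⟨fun _ => mem_strings_iff hP, fun _ => mem_virtualCells_iff hP, fun _ => mem_costrings_iff hP,
    fun _ => mem_virtualCones_iff hP, fun _ => subset_faces_of_mem_strings hP,
    fun _ => subset_faces_of_mem_virtualCells hP,
    fun _ => subset_normalFan_of_mem_virtualCones hP, fun _ hC => hC.subset,
    isPartialOrderOn_strings hP, isPartialOrderOn_virtualCones hP,
    isPartialOrderOn_costrings hP, isPartialOrderOn_virtualCells hP,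
    isAntiIsoOn_conesOf_strings hP, isAntiIsoOn_facesOf_virtualCones hP,
    isAntiIsoOn_conesOf_virtualCells hP, isAntiIsoOn_facesOf_costrings hP,
    coherentStrings_subset_strings hP, isAntiIsoOn_stringOfCone hP,
    isEmbeddingOn_virtualConeOfCone hP, fun σ _ => conesOf_stringOfCone σ,
    coherentCostrings_subset_costrings hP, isAntiIsoOn_costringOfCell hP,
    isEmbeddingOn_virtualCellOfCell hP, fun _ => conesOf_virtualCellOfCell hP⟩

theorem theoremA {V W : Type*} [NormedAddCommGroup V] [NormedSpace ℝ V] [FiniteDimensional ℝ V]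
    [NormedAddCommGroup W] [NormedSpace ℝ W] [FiniteDimensional ℝ W]
    (π : V →L[ℝ] W) (hπ : Function.Surjective π)
    (P : Set V) (hP : FanDuality.IsPolytope P) (hfull : affineSpan ℝ P = ⊤) :
    open FanDuality in
    -- the correspondences between collections of faces and collections of normal cones
    (∀ A ⊆ faces P, (A ∈ strings P π ↔ conesOf P A ∈ virtualCones P π)) ∧
    (∀ A ⊆ faces P, (A ∈ virtualCells P π ↔ conesOf P A ∈ costrings P π)) ∧
    (∀ C ⊆ normalFan P, (C ∈ costrings P π ↔ facesOf P C ∈ virtualCells P π)) ∧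
    (∀ C ⊆ normalFan P, (C ∈ virtualCones P π ↔ facesOf P C ∈ strings P π)) ∧
    -- members of the four posets are collections of faces, respectively of normal cones
    (∀ A ∈ strings P π, A ⊆ faces P) ∧ (∀ A ∈ virtualCells P π, A ⊆ faces P) ∧
    (∀ C ∈ virtualCones P π, C ⊆ normalFan P) ∧ (∀ C ∈ costrings P π, C ⊆ normalFan P) ∧
    -- the four orders are partial orders
    IsPartialOrderOn (strings P π) UnionLE ∧
    IsPartialOrderOn (virtualCones P π) (VirtualConeLE P π) ∧
    IsPartialOrderOn (costrings P π) UnionLE ∧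
    IsPartialOrderOn (virtualCells P π) (VirtualCellLE P π) ∧
    -- the correspondences reverse the orders
    IsAntiIsoOn (conesOf P) (strings P π) UnionLE (virtualCones P π) (VirtualConeLE P π) ∧
    IsAntiIsoOn (facesOf P) (virtualCones P π) (VirtualConeLE P π) (strings P π) UnionLE ∧
    IsAntiIsoOn (conesOf P) (virtualCells P π) (VirtualCellLE P π) (costrings P π) UnionLE ∧
    IsAntiIsoOn (facesOf P) (costrings P π) UnionLE (virtualCells P π) (VirtualCellLE P π) ∧
    -- they extend the anti-isomorphism between `Γ^*` and `T_coh`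
    coherentStrings P π ⊆ strings P π ∧
    IsAntiIsoOn (stringOfCone P π) (cones P π) (· ⊆ ·) (coherentStrings P π) UnionLE ∧
    IsEmbeddingOn (virtualConeOfCone P π) (cones P π) (· ⊆ ·)
      (virtualCones P π) (VirtualConeLE P π) ∧
    (∀ σ ∈ cones P π, conesOf P (stringOfCone P π σ) = virtualConeOfCone P π σ) ∧
    -- they extend the anti-isomorphism between `Γ` and `T^*_coh`
    coherentCostrings P π ⊆ costrings P π ∧
    IsAntiIsoOn (costringOfCell P π) (cells P π) (· ⊆ ·) (coherentCostrings P π) UnionLE ∧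
    IsEmbeddingOn (virtualCellOfCell P π) (cells P π) (· ⊆ ·)
      (virtualCells P π) (VirtualCellLE P π) ∧
    (∀ c ∈ cells P π, conesOf P (virtualCellOfCell P π c) = costringOfCell P π c) :=
  theoremA_general π P hP
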